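/- Work with topological spaces up to homotopy equivalence (the interpretation of homotopy type theory in spaces: types are spaces, equality of types is homotopy equivalence, and all pushouts and pullbacks are homotopy pushouts and homotopy pullbacks). Let $m\ge 1$, and let $\mathbb Z_m$ be the discrete space with $m$ elements. The join $A\ast B$ is the homotopy pushout of the projections $A\leftarrow A\times B\to B$; the $n$-fold join is given by $A^{\ast 0}=\emptyset$ and $A^{\ast(n+1)}=A^{\ast n}\ast A$. We write $S^{n-1}$ for the unit sphere of $\mathbb R^n$ (so $S^{-1}=\emptyset$). For $k\ge 0$, $\bigvee_k A$ is the wedge of $k$ copies of a pointed space $A$ (a point if $k=0$), and by convention $\bigvee_1 S^{-1}=S^{-1}$. (1) For every $n\ge 0$ there is a homotopy equivalence $$\mathbb Z_m^{\ast n}\;\simeq\;\bigvee_{(m-1)^n}S^{n-1}\qquad(\text{with } (m-1)^0=1).$$ (2) Let $B$ be a delooping of $\mathbb Z_m$, i.e. a pointed path-connected space with a homotopy equivalence $\Omega B\simeq\mathbb Z_m$ carrying concatenation of loops to addition. The join of two maps $f:A\to B$ and $g:A'\to B$ is the induced map $f\ast g:A\ast_B A'\to B$, where $A\ast_B A'$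 is the homotopy pushout of $A\leftarrow A\times_B A'\to A'$ and $A\times_B A'$ is the homotopy pullback. Let $f:1\to B$ be the base point, let $f^{\ast 0}$ be the map $\emptyset\to B$ and $f^{\ast(n+1)}=f^{\ast n}\ast f$, and let $\tilde L^n$ ($n\ge 0$) be the source of $f^{\ast(n+1)}$ (so $\tilde L^0\simeq 1$), with the canonical map $\tilde L^n\to\tilde L^{n+1}$. Then for every $n\ge 0$ the space $\tilde L^{n+1}$ is obtained from $\tilde L^n$ by attaching $(m-1)^{n+1}$ cells of dimension $n+1$: writing $\mathrm{Fin}(k)$ for the discrete space with $k$ elements and $k=(m-1)^{n+1}$, there is a map $\varphi:\mathrm{Fin}(k)\times S^n\to\tilde L^n$ such that the homotopy pushout of $\tilde L^n\xleftarrow{\ \varphi\ }\mathrm{Fin}(k)\times S^n\xrightarrow{\ \mathrm{pr}_1\ }\mathrm{Fin}(k)$ is homotopy equivalent to $\tilde L^{n+1}$, by an equivalence whose restriction to $\tilde L^n$ is homotopic to the canonical map $\tilde L^n\to\tilde L^{n+1}$. -/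

import Mathlib

/-! Types are interpreted as topological spaces, equality of types as homotopy equivalence, and all
pushouts and pullbacks are homotopy pushouts and homotopy pullbacks. -/

namespace HoTop

open scoped unitInterval

universe u v w

section Pushout

variable {X : Type u} {A : Type v} {B : Type w} [TopologicalSpace X] [TopologicalSpace A]
  [TopologicalSpace B]

/-- The gluing relation of the double mapping cylinder: `(0, x) ~ f x` and `(1, x) ~ g x`. -/
inductive PushoutRel (f : C(X, A)) (g : C(X, B)) : A ⊕ (I × X) ⊕ B → A ⊕ (I × X) ⊕ B → Prop
  | left (x : X) : PushoutRel f g (Sum.inr (Sum.inl (0, x))) (Sum.inl (f x))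
  | right (x : X) : PushoutRel f g (Sum.inr (Sum.inl (1, x))) (Sum.inr (Sum.inr (g x)))

/-- The homotopy pushout (double mapping cylinder) of `f : X → A` and `g : X → B`. -/
def HPushout (f : C(X, A)) (g : C(X, B)) : Type (max u v w) :=
  Quot (PushoutRel f g)

instance (f : C(X, A)) (g : C(X, B)) : TopologicalSpace (HPushout f g) :=
  inferInstanceAs (TopologicalSpace (Quot (PushoutRel f g)))

/-- The canonical map from the first leg into the homotopy pushout. -/
def HPushout.inl (f : C(X, A)) (g : C(X, B)) : C(A, HPushout f g) where
  toFun a := Quot.mk _ (Sum.inl a)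
  continuous_toFun := continuous_quot_mk.comp continuous_inl

/-- The map out of a homotopy pushout that is given by a square commuting up to the homotopy `H`. -/
def HPushout.desc {f : C(X, A)} {g : C(X, B)} {C : Type*} [TopologicalSpace C]
    (a : C(A, C)) (b : C(B, C)) (H : ContinuousMap.Homotopy (a.comp f) (b.comp g)) :
    C(HPushout f g, C) where
  toFun := Quot.lift (Sum.elim a (Sum.elim H b)) (by
    rintro _ _ (x | x)
    · simp
    · simp)
  continuous_toFun := continuous_quot_lift _ (by fun_prop)

end Pushout

section Pullback

variable {A B C : Type u} [TopologicalSpace A] [TopologicalSpace B] [TopologicalSpace C]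

/-- The homotopy pullback of `f : A → C` and `g : B → C`: triples of a point `a` of `A`, a path
in `C` from `f a` to `g b`, and a point `b` of `B`. -/
def HPullback (f : C(A, C)) (g : C(B, C)) : Type u :=
  {p : A × C(I, C) × B // p.2.1 0 = f p.1 ∧ p.2.1 1 = g p.2.2}

instance (f : C(A, C)) (g : C(B, C)) : TopologicalSpace (HPullback f g) :=
  inferInstanceAs (TopologicalSpace
    {p : A × C(I, C) × B // p.2.1 0 = f p.1 ∧ p.2.1 1 = g p.2.2})

/-- First projection of the homotopy pullback. -/
def HPullback.fst (f : C(A, C)) (g : C(B, C)) : C(HPullback f g, A) where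
  toFun p := p.1.1
  continuous_toFun := continuous_fst.comp continuous_subtype_val

/-- Second projection of the homotopy pullback. -/
def HPullback.snd (f : C(A, C)) (g : C(B, C)) : C(HPullback f g, B) where
  toFun p := p.1.2.2
  continuous_toFun := continuous_snd.comp (continuous_snd.comp continuous_subtype_val)

/-- The tautological homotopy that fills the homotopy pullback square. -/
def HPullback.homotopy (f : C(A, C)) (g : C(B, C)) :
    ContinuousMap.Homotopy (f.comp (HPullback.fst f g)) (g.comp (HPullback.snd f g)) where
  toFun q := q.2.1.2.1 q.1
  continuous_toFun := by
    have h : Continuous fun q : I × HPullback f g => q.2.1.2.1 :=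
      continuous_fst.comp (continuous_snd.comp (continuous_subtype_val.comp continuous_snd))
    exact h.eval continuous_fst
  map_zero_left p := p.2.1
  map_one_left p := p.2.2

/-- The source `A *_C B` of the join of two maps `f : A → C` and `g : B → C`. -/
abbrev JoinOver (f : C(A, C)) (g : C(B, C)) : Type u :=
  HPushout (HPullback.fst f g) (HPullback.snd f g)

/-- The join `f * g : A *_C B → C` of two maps with the same target. -/
def joinMap (f : C(A, C)) (g : C(B, C)) : C(JoinOver f g, C) :=
  HPushout.desc f g (HPullback.homotopy f g)

/-- The `n`-th iterated join `f^{*n}` of a map `f : A → C`, together with its source. It starts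
with `∅ → C`, and `f^{*(n+1)} = f^{*n} * f`. -/
def iterJoinMap (f : C(A, C)) : ℕ → (E : TopCat.{u}) × C(E, C)
  | 0 => ⟨TopCat.of PEmpty.{u + 1}, ⟨PEmpty.elim, continuous_of_discreteTopology⟩⟩
  | n + 1 => ⟨TopCat.of (JoinOver (iterJoinMap f n).2 f), joinMap (iterJoinMap f n).2 f⟩

end Pullback

/-- The join `A * B` of two spaces: the homotopy pushout of the projections of `A × B`. -/
abbrev Join (A : Type u) (B : Type v) [TopologicalSpace A] [TopologicalSpace B] :
    Type (max u v) :=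
  HPushout (ContinuousMap.fst : C(A × B, A)) (ContinuousMap.snd : C(A × B, B))

/-- The `n`-fold join `A^{*n}`, with `A^{*0} = ∅` and `A^{*(n+1)} = A^{*n} * A`. -/
def joinPow (A : Type u) [TopologicalSpace A] : ℕ → TopCat.{u}
  | 0 => TopCat.of PEmpty.{u + 1}
  | n + 1 => TopCat.of (Join (joinPow A n) A)

/-- The unit sphere of `ℝ^d`, that is `S^{d-1}`; in particular `S^{-1} = ∅`. -/
abbrev UnitSphere (d : ℕ) : Type :=
  Metric.sphere (0 : EuclideanSpace ℝ (Fin d)) 1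

/-- The base point `(1, 0, …, 0)` of `S^n`. -/
noncomputable def sphereBase (n : ℕ) : UnitSphere (n + 1) :=
  ⟨EuclideanSpace.single 0 1, by simp⟩

/-- The wedge sum of `k` copies of the pointed space `(A, a)`: the homotopy pushout of
`1 ← Fin k → Fin k × A`, where the second map picks the base point of each copy. For `k = 0` it is
a point. -/
abbrev Wedge (k : ℕ) (A : Type u) [TopologicalSpace A] (a : A) : Type u :=
  HPushout (ContinuousMap.const (Fin k) PUnit.unit.{1})
    (⟨fun i => (i, a), by fun_prop⟩ : C(Fin k, Fin k × A))

/-- The pointed space `(B, b)` is a delooping of the discrete group `G` (written additively): it is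
path connected, and its loop space is homotopy equivalent to `G` in such a way that concatenation
of loops corresponds to addition. -/
structure IsDelooping (G : Type v) [AddGroup G] [TopologicalSpace G] [DiscreteTopology G]
    (B : Type u) [TopologicalSpace B] (b : B) : Prop where
  pathConnected : PathConnectedSpace B
  loopEquiv : ∃ e : ContinuousMap.HomotopyEquiv (Path b b) G,
    ∀ p q : Path b b, e (p.trans q) = e p + e q

/-- The space `L̃^n`: the source of the `(n+1)`-st iterated join of the map `1 → B` that picks the
base point `b`. -/
def resolution (B : Type u) [TopologicalSpace B] (b : B) (n : ℕ) : TopCat.{u} :=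
  (iterJoinMap (ContinuousMap.const PUnit.{u + 1} b) (n + 1)).1

/-- The canonical map `L̃^n → L̃^{n+1}`. -/
def resolutionIncl (B : Type u) [TopologicalSpace B] (b : B) (n : ℕ) :
    C(resolution B b n, resolution B b (n + 1)) :=
  HPushout.inl _ _

/-- `j : Y → Z` exhibits `Z`, up to homotopy, as obtained from `Y` by attaching `k` cells of
dimension `n + 1`: there is an attaching map `φ : Fin k × S^n → Y` such that `j` is the bottom map
of a homotopy pushout square of `φ` and the projection `Fin k × S^n → Fin k`. -/
def AttachesCells (k n : ℕ) {Y : Type u} {Z : Type v} [TopologicalSpace Y] [TopologicalSpace Z]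
    (j : C(Y, Z)) : Prop :=
  ∃ (φ : C(Fin k × UnitSphere (n + 1), Y))
    (e : ContinuousMap.HomotopyEquiv (HPushout φ ContinuousMap.fst) Z),
    (e.toFun.comp (HPushout.inl φ ContinuousMap.fst)).Homotopic j

end HoTop

/-! Write `ZMod m` as one point and `l = m - 1` further points. The join of J with a point is
contractible, so J * (1 + Fin l) is the homotopy pushout of 1 ← J × Fin l → Fin l: starting from a
point, l copies of J are coned off. For J = S^{d-1} this is a wedge of l suspensions S^d. If J is a
wedge of k spheres, coning off a copy of J amounts to coning off each of its summands
(`exists_cone_wedge`), which gives l * k spheres of one dimension more. Induction on the number of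
factors proves (1).

For (2), the homotopy pullback in the join of p : E → B with the base point f is the homotopy fibre
F of p, so the source of p * f is the homotopy pushout of E ← F → 1. If F is a wedge of k spheres
S^n, coning it off attaches k cells of dimension n + 1 (`attachesCells_of_fiber`). It remains to see
that the fibre of f^{*n} is the n-fold join of `ZMod m`. Since ΩB ≃ `ZMod m`, this follows by
induction from `exists_join_fiber`: the fibre of p * f is F * ΩB.

That lemma rests on descent: pulling back along a map to B commutes with homotopy pushouts over B
(`isHEquiv_pulledComparison`). Applied to a strict model of the square of p * f, it gives a span F ←
F × ΩB → ΩB in which one leg is concatenation. The shear (x, ℓ) ↦ (x ℓ⁻¹, ℓ) turns this leg into a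
projection, up to homotopy.

The spaces are arbitrary, so everything is done with explicit homotopies of double mapping cylinders
and paths. Both are extended to real parameters by clamping, which lets affine reparametrizations
leave the unit interval. -/

namespace HoTop

open scoped unitInterval
open ContinuousMap

universe u v

/-! ### Homotopy equivalences and gluing of homotopies -/

section IsHEquiv

variable {X Y Z T : Type*} [TopologicalSpace X] [TopologicalSpace Y] [TopologicalSpace Z]
  [TopologicalSpace T]

/-- A continuous map is a homotopy equivalence. -/
def IsHEquiv (f : C(X, Y)) : Prop :=
  ∃ g : C(Y, X), (g.comp f).Homotopic (.id X) ∧ (f.comp g).Homotopic (.id Y)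

theorem IsHEquiv.exists_equiv {f : C(X, Y)} (h : IsHEquiv f) :
    ∃ e : HomotopyEquiv X Y, e.toFun = f :=
  let ⟨g, h₁, h₂⟩ := h
  ⟨⟨f, g, h₁, h₂⟩, rfl⟩

theorem IsHEquiv.nonempty {f : C(X, Y)} (h : IsHEquiv f) : Nonempty (HomotopyEquiv X Y) :=
  ⟨h.exists_equiv.choose⟩

theorem isHEquiv_toFun (e : HomotopyEquiv X Y) : IsHEquiv e.toFun :=
  ⟨e.invFun, e.left_inv, e.right_inv⟩

theorem isHEquiv_homeomorph (e : X ≃ₜ Y) : IsHEquiv (e : C(X, Y)) :=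
  isHEquiv_toFun e.toHomotopyEquiv

theorem isHEquiv_of_inverse (f : C(X, Y)) (g : C(Y, X)) (h₁ : ∀ x, g (f x) = x)
    (h₂ : ∀ y, f (g y) = y) : IsHEquiv f := by
  refine ⟨g, ?_, ?_⟩
  · rw [show g.comp f = .id X from ContinuousMap.ext h₁]
  · rw [show f.comp g = .id Y from ContinuousMap.ext h₂]

theorem isHEquiv_id : IsHEquiv (ContinuousMap.id X) := ⟨.id X, .refl _, .refl _⟩

theorem IsHEquiv.of_homotopic {f f' : C(X, Y)} (hf : IsHEquiv f) (h : f.Homotopic f') :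
    IsHEquiv f' := by
  obtain ⟨g, h₁, h₂⟩ := hf
  exact ⟨g, (Homotopic.comp (.refl g) h.symm).trans h₁, (Homotopic.comp h.symm (.refl g)).trans h₂⟩

/-- A map with a left and a right homotopy inverse is a homotopy equivalence. -/
theorem isHEquiv_of_left_right {f : C(X, Y)} {l r : C(Y, X)}
    (hl : (l.comp f).Homotopic (.id X)) (hr : (f.comp r).Homotopic (.id Y)) : IsHEquiv f := by
  have h : l.Homotopic r := by
    have h₁ : (l.comp (f.comp r)).Homotopic l := Homotopic.comp (.refl l) hr
    have h₂ : ((l.comp f).comp r).Homotopic r := Homotopic.comp hl (.refl r)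
    exact h₁.symm.trans h₂
  exact ⟨l, hl, (Homotopic.comp (.refl f) h).trans hr⟩

theorem IsHEquiv.comp {g : C(Y, Z)} {f : C(X, Y)} (hg : IsHEquiv g) (hf : IsHEquiv f) :
    IsHEquiv (g.comp f) := by
  obtain ⟨g', h₁, h₂⟩ := hg
  obtain ⟨f', h₃, h₄⟩ := hf
  refine ⟨f'.comp g', ?_, ?_⟩
  · have : (f'.comp ((g'.comp g).comp f)).Homotopic (f'.comp f) :=
      Homotopic.comp (.refl f') (Homotopic.comp h₁ (.refl f))
    exact this.trans h₃
  · have : (g.comp ((f.comp f').comp g')).Homotopic (g.comp g') :=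
      Homotopic.comp (.refl g) (Homotopic.comp h₄ (.refl g'))
    exact this.trans h₂

theorem IsHEquiv.of_comp_left {g : C(Y, Z)} {f : C(X, Y)} (hg : IsHEquiv g)
    (hgf : IsHEquiv (g.comp f)) : IsHEquiv f := by
  obtain ⟨g', h₁, h₂⟩ := hg
  have h : (g'.comp (g.comp f)).Homotopic f := Homotopic.comp h₁ (.refl f)
  exact (IsHEquiv.comp ⟨g, h₂, h₁⟩ hgf).of_homotopic h

theorem IsHEquiv.of_comp_right {g : C(Y, Z)} {f : C(X, Y)} (hf : IsHEquiv f)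
    (hgf : IsHEquiv (g.comp f)) : IsHEquiv g := by
  obtain ⟨f', h₁, h₂⟩ := hf
  have h : ((g.comp f).comp f').Homotopic g := Homotopic.comp (.refl g) h₂
  exact (IsHEquiv.comp hgf ⟨f, h₂, h₁⟩).of_homotopic h

/-- The middle map in the two-out-of-six property. -/
theorem IsHEquiv.two_of_six {h : C(Z, T)} {g : C(Y, Z)} {f : C(X, Y)}
    (hgf : IsHEquiv (g.comp f)) (hhg : IsHEquiv (h.comp g)) : IsHEquiv g := by
  obtain ⟨a, -, ha⟩ := hgf
  obtain ⟨b, hb, -⟩ := hhg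
  exact isHEquiv_of_left_right (l := b.comp h) (r := f.comp a) hb ha

theorem IsHEquiv.prodMap {f : C(X, Y)} {g : C(Z, T)} (hf : IsHEquiv f) (hg : IsHEquiv g) :
    IsHEquiv (f.prodMap g) := by
  obtain ⟨a, h₁, h₂⟩ := hf
  obtain ⟨b, h₃, h₄⟩ := hg
  exact ⟨a.prodMap b, h₁.prodMap h₃, h₂.prodMap h₄⟩

/-- Homotopies parametrized by the real line. -/
theorem exists_real_homotopy {f g : C(X, Y)} (h : f.Homotopic g) :
    ∃ H : C(ℝ × X, Y), (∀ x, H (0, x) = f x) ∧ (∀ x, H (1, x) = g x) := by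
  obtain ⟨F⟩ := h
  exact ⟨⟨fun q => F (Set.projIcc 0 1 zero_le_one q.1, q.2), by fun_prop⟩, by simp, by simp⟩

/-- Gluing of two maps along a real parameter at `0`. -/
noncomputable def glueZero (F G : C(ℝ × X, Y)) (h : ∀ x, F (0, x) = G (0, x)) : C(ℝ × X, Y) where
  toFun q := if q.1 ≤ 0 then F q else G q
  continuous_toFun := Continuous.if_le (by fun_prop) (by fun_prop) (by fun_prop) (by fun_prop) (by
    rintro ⟨t, x⟩ rfl
    exact h x)

theorem glueZero_of_nonpos {F G : C(ℝ × X, Y)} {h : ∀ x, F (0, x) = G (0, x)} {t : ℝ} {x : X}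
    (ht : t ≤ 0) : glueZero F G h (t, x) = F (t, x) := if_pos ht

theorem glueZero_of_nonneg {F G : C(ℝ × X, Y)} {h : ∀ x, F (0, x) = G (0, x)} {t : ℝ} {x : X}
    (ht : 0 ≤ t) : glueZero F G h (t, x) = G (t, x) := by
  by_cases h0 : t ≤ 0
  · obtain rfl : t = 0 := le_antisymm h0 ht
    exact (if_pos h0).trans (h x)
  · exact if_neg h0

theorem continuous_prod_sum {D : Type*} [TopologicalSpace D] {F : D × (X ⊕ Y) → Z}
    (h₁ : Continuous fun q : D × X => F (q.1, .inl q.2))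
    (h₂ : Continuous fun q : D × Y => F (q.1, .inr q.2)) : Continuous F := by
  rw [← (Homeomorph.prodSumDistrib (X := D) (Y := X) (Z := Y)).symm.comp_continuous_iff']
  exact continuous_sum_dom.2 ⟨h₁, h₂⟩

end IsHEquiv

/-! ### Maps and homotopies out of double mapping cylinders -/

namespace HPushout

variable {W A B Y : Type*} [TopologicalSpace W] [TopologicalSpace A] [TopologicalSpace B]
  [TopologicalSpace Y]

/-- The canonical map from the second leg into the homotopy pushout. -/
def inr (f : C(W, A)) (g : C(W, B)) : C(B, HPushout f g) where
  toFun b := Quot.mk _ (.inr (.inr b))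
  continuous_toFun := continuous_quot_mk.comp (continuous_inr.comp continuous_inr)

/-- The canonical map from the cylinder, extended constantly to `ℝ × W`. -/
noncomputable def line (f : C(W, A)) (g : C(W, B)) : C(ℝ × W, HPushout f g) where
  toFun q := Quot.mk _ (.inr (.inl (Set.projIcc 0 1 zero_le_one q.1, q.2)))
  continuous_toFun := continuous_quot_mk.comp (continuous_inr.comp (continuous_inl.comp
    (by fun_prop)))

variable {f : C(W, A)} {g : C(W, B)}

theorem line_of_le_zero {t : ℝ} (ht : t ≤ 0) (w : W) : line f g (t, w) = inl f g (f w) := by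
  have : Set.projIcc (0 : ℝ) 1 zero_le_one t = 0 := Set.projIcc_of_le_left _ ht
  exact (congrArg (fun s : I => (Quot.mk _ (Sum.inr (Sum.inl (s, w))) : HPushout f g)) this).trans
    (Quot.sound (PushoutRel.left w))

theorem line_of_one_le {t : ℝ} (ht : 1 ≤ t) (w : W) : line f g (t, w) = inr f g (g w) := by
  have : Set.projIcc (0 : ℝ) 1 zero_le_one t = 1 := Set.projIcc_of_right_le _ ht
  exact (congrArg (fun s : I => (Quot.mk _ (Sum.inr (Sum.inl (s, w))) : HPushout f g)) this).trans
    (Quot.sound (PushoutRel.right w))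

@[simp] theorem line_zero (w : W) : line f g (0, w) = inl f g (f w) := line_of_le_zero le_rfl w

@[simp] theorem line_one (w : W) : line f g (1, w) = inr f g (g w) := line_of_one_le le_rfl w

theorem line_coe (t : I) (w : W) : line f g (t, w) = Quot.mk _ (.inr (.inl (t, w))) := by
  change Quot.mk _ _ = _
  simp

theorem ind {p : HPushout f g → Prop} (hl : ∀ a, p (inl f g a)) (hr : ∀ b, p (inr f g b))
    (hc : ∀ t ∈ I, ∀ w, p (line f g (t, w))) (x : HPushout f g) : p x := by
  induction x using Quot.ind with | mk x => ?_
  rcases x with a | ⟨t, w⟩ | b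
  · exact hl a
  · exact line_coe (f := f) (g := g) t w ▸ hc t t.2 w
  · exact hr b

/-- Continuity of a map out of the product of a homotopy pushout and a locally compact space. -/
theorem continuous_prod {D : Type*} [TopologicalSpace D] [LocallyCompactSpace D]
    {F : D × HPushout f g → Y} (hl : Continuous fun q : D × A => F (q.1, inl f g q.2))
    (hr : Continuous fun q : D × B => F (q.1, inr f g q.2))
    (hc : Continuous fun q : D × (ℝ × W) => F (q.1, line f g q.2)) : Continuous F := by
  have hq : Topology.IsQuotientMap (Quot.mk (PushoutRel f g)) := isQuotientMap_quot_mk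
  -- The product of a quotient map with the identity of a locally compact space is again a quotient
  -- map.
  refine hq.continuous_lift_prod_right (continuous_prod_sum hl (continuous_prod_sum ?_ hr))
  have : Continuous fun q : D × (I × W) => F (q.1, line f g (q.2.1, q.2.2)) :=
    hc.comp (by fun_prop : Continuous fun q : D × (I × W) => (q.1, ((q.2.1 : ℝ), q.2.2)))
  simp only [line_coe] at this
  exact this

/-- The map out of a homotopy pushout given by a homotopy parametrized by the real line. -/
def descLine (a : C(A, Y)) (b : C(B, Y)) (h : C(ℝ × W, Y)) (h₀ : ∀ w, h (0, w) = a (f w))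
    (h₁ : ∀ w, h (1, w) = b (g w)) : C(HPushout f g, Y) :=
  desc a b
    { toFun := fun q => h (q.1, q.2)
      continuous_toFun := by fun_prop
      map_zero_left := by simpa using h₀
      map_one_left := by simpa using h₁ }

section descLine

variable (a : C(A, Y)) (b : C(B, Y)) (h : C(ℝ × W, Y)) (h₀ : ∀ w, h (0, w) = a (f w))
  (h₁ : ∀ w, h (1, w) = b (g w))

@[simp] theorem descLine_inl (x : A) : descLine a b h h₀ h₁ (inl f g x) = a x := rfl

@[simp] theorem descLine_inr (x : B) : descLine a b h h₀ h₁ (inr f g x) = b x := rfl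

theorem descLine_line {t : ℝ} (ht : t ∈ I) (w : W) :
    descLine a b h h₀ h₁ (line f g (t, w)) = h (t, w) := by
  lift t to I using ht
  rw [line_coe]
  rfl

/-- `line` is constant beyond both ends even where `h` is not, hence the clamp. Being valid for
every real `t`, the formula gives the continuity on the cylinder that `descFamily` needs. -/
theorem descLine_line_clamp (t : ℝ) (w : W) :
    descLine a b h h₀ h₁ (line f g (t, w)) = h (max 0 (min t 1), w) := by
  rcases le_total t 0 with h0 | h0
  · rw [line_of_le_zero h0, descLine_inl, min_eq_left (h0.trans zero_le_one), max_eq_left h0, h₀]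
  · rcases le_total t 1 with h1 | h1
    · rw [descLine_line _ _ _ _ _ ⟨h0, h1⟩, min_eq_left h1, max_eq_right h0]
    · rw [line_of_one_le h1, descLine_inr, min_eq_right h1, max_eq_right zero_le_one, h₁]

end descLine

theorem hom_ext {φ ψ : C(HPushout f g, Y)} (hl : ∀ a, φ (inl f g a) = ψ (inl f g a))
    (hr : ∀ b, φ (inr f g b) = ψ (inr f g b))
    (hc : ∀ t ∈ I, ∀ w, φ (line f g (t, w)) = ψ (line f g (t, w))) : φ = ψ :=
  ContinuousMap.ext fun x => ind (p := fun x => φ x = ψ x) hl hr hc x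

section descFamily

variable {D : Type*} [TopologicalSpace D] [LocallyCompactSpace D]
  (a : C(D × A, Y)) (b : C(D × B, Y)) (h : C(D × ℝ × W, Y))
  (h₀ : ∀ s w, h (s, 0, w) = a (s, f w)) (h₁ : ∀ s w, h (s, 1, w) = b (s, g w))

/-- A family of maps out of a homotopy pushout, parametrized by a locally compact space. -/
def descFamily : C(D × HPushout f g, Y) where
  toFun q := descLine ⟨fun a' => a (q.1, a'), by fun_prop⟩ ⟨fun b' => b (q.1, b'), by fun_prop⟩
      ⟨fun p => h (q.1, p), by fun_prop⟩ (h₀ q.1) (h₁ q.1) q.2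
  continuous_toFun := by
    refine continuous_prod a.continuous b.continuous ?_
    have : Continuous fun q : D × ℝ × W => h (q.1, max 0 (min q.2.1 1), q.2.2) := by fun_prop
    exact this.congr fun q => (descLine_line_clamp ⟨fun a' => a (q.1, a'), by fun_prop⟩
      ⟨fun b' => b (q.1, b'), by fun_prop⟩ ⟨fun p => h (q.1, p), by fun_prop⟩
      (h₀ q.1) (h₁ q.1) q.2.1 q.2.2).symm

@[simp] theorem descFamily_inl (s : D) (x : A) :
    descFamily a b h h₀ h₁ (s, inl f g x) = a (s, x) := rfl

theorem descFamily_line (s : D) {t : ℝ} (ht : t ∈ I) (w : W) :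
    descFamily a b h h₀ h₁ (s, line f g (t, w)) = h (s, t, w) :=
  descLine_line (⟨fun a' => a (s, a'), by fun_prop⟩ : C(A, Y)) ⟨fun b' => b (s, b'), by fun_prop⟩
    ⟨fun p => h (s, p), by fun_prop⟩ (h₀ s) (h₁ s) ht w

end descFamily

/-- Two maps out of a homotopy pushout are homotopic if they are so on both legs and on the
cylinder, compatibly. The parameters are the time, the height in the cylinder and the point. -/
theorem homotopic_of {φ ψ : C(HPushout f g, Y)} (Ha : C(ℝ × A, Y)) (Hb : C(ℝ × B, Y))
    (Hc : C(ℝ × ℝ × W, Y)) (hf : ∀ s ∈ I, ∀ w, Hc (s, 0, w) = Ha (s, f w))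
    (hg : ∀ s ∈ I, ∀ w, Hc (s, 1, w) = Hb (s, g w))
    (ha₀ : ∀ a, Ha (0, a) = φ (inl f g a)) (ha₁ : ∀ a, Ha (1, a) = ψ (inl f g a))
    (hb₀ : ∀ b, Hb (0, b) = φ (inr f g b)) (hb₁ : ∀ b, Hb (1, b) = ψ (inr f g b))
    (hc₀ : ∀ t ∈ I, ∀ w, Hc (0, t, w) = φ (line f g (t, w)))
    (hc₁ : ∀ t ∈ I, ∀ w, Hc (1, t, w) = ψ (line f g (t, w))) : φ.Homotopic ψ := by
  let K : C(I × HPushout f g, Y) :=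
    descFamily ⟨fun q : I × A => Ha (q.1, q.2), by fun_prop⟩
      ⟨fun q : I × B => Hb (q.1, q.2), by fun_prop⟩
      ⟨fun q : I × ℝ × W => Hc (q.1, q.2), by fun_prop⟩
      (fun s => hf s s.2) (fun s => hg s s.2)
  refine ⟨{ toContinuousMap := K, map_zero_left := ?_, map_one_left := ?_ }⟩
  · refine ind ha₀ hb₀ fun t ht w => ?_
    rw [← hc₀ t ht w]
    exact descFamily_line _ _ _ _ _ 0 ht w
  · refine ind ha₁ hb₁ fun t ht w => ?_
    rw [← hc₁ t ht w]
    exact descFamily_line _ _ _ _ _ 1 ht w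

end HPushout

/-! ### Homotopy invariance and pasting of homotopy pushouts -/

namespace HPushout

variable {W A B A' B' Y : Type*} [TopologicalSpace W] [TopologicalSpace A] [TopologicalSpace B]
  [TopologicalSpace A'] [TopologicalSpace B'] [TopologicalSpace Y]

section move

variable {f f' : C(W, A)} {g : C(W, B)}

/-- The homotopy `h` in the left leg for parameters in `[-1, 0]`, followed by the cylinder for
parameters in `[0, 1]`. -/
noncomputable def moveStrip (f' : C(W, A)) (g : C(W, B)) (h : C(ℝ × W, A))
    (h₁ : ∀ w, h (1, w) = f' w) : C(ℝ × W, HPushout f' g) :=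
  glueZero ⟨fun q => inl f' g (h (1 + q.1, q.2)), by fun_prop⟩ (line f' g) (by simp [h₁])

theorem moveStrip_of_nonpos {h : C(ℝ × W, A)} {h₁ : ∀ w, h (1, w) = f' w} {t : ℝ} (ht : t ≤ 0)
    (w : W) : moveStrip f' g h h₁ (t, w) = inl f' g (h (1 + t, w)) :=
  glueZero_of_nonpos ht

theorem moveStrip_of_nonneg {h : C(ℝ × W, A)} {h₁ : ∀ w, h (1, w) = f' w} {t : ℝ} (ht : 0 ≤ t)
    (w : W) : moveStrip f' g h h₁ (t, w) = line f' g (t, w) :=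
  glueZero_of_nonneg ht

/-- The map of homotopy pushouts induced by a homotopy of left legs. -/
noncomputable def moveLeft (f f' : C(W, A)) (g : C(W, B)) (h : C(ℝ × W, A))
    (h₀ : ∀ w, h (0, w) = f w) (h₁ : ∀ w, h (1, w) = f' w) : C(HPushout f g, HPushout f' g) :=
  descLine (inl f' g) (inr f' g)
    ⟨fun q => moveStrip f' g h h₁ (2 * q.1 - 1, q.2), by fun_prop⟩
    (by intro w; simp [moveStrip_of_nonpos, h₀])
    (by intro w; norm_num [moveStrip_of_nonneg])

theorem moveLeft_line {h : C(ℝ × W, A)} (h₀ : ∀ w, h (0, w) = f w) (h₁ : ∀ w, h (1, w) = f' w)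
    {t : ℝ} (ht : t ∈ I) (w : W) :
    moveLeft f f' g h h₀ h₁ (line f g (t, w)) = moveStrip f' g h h₁ (2 * t - 1, w) :=
  descLine_line _ _ _ _ _ ht w

/-- The composite runs along `h`, back along `h'`, and then through the cylinder. All of this
factors through the strip of `h'`: the parameter `max (-2 t) (4 t - 3)` goes from 0 down to -1 and
then up to 1, and contracts linearly to `t` with its ends fixed. -/
theorem moveLeft_comp_reverse {h h' : C(ℝ × W, A)} (h₀ : ∀ w, h (0, w) = f w)
    (h₁ : ∀ w, h (1, w) = f' w) (hh : ∀ t w, h' (t, w) = h (1 - t, w)) :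
    ((moveLeft f' f g h' (by simp [hh, h₁]) (by simp [hh, h₀])).comp
      (moveLeft f f' g h h₀ h₁)).Homotopic (.id _) := by
  have h₁' : ∀ w, h' (1, w) = f w := by simp [hh, h₀]
  refine homotopic_of ⟨fun q => inl f g q.2, by fun_prop⟩ ⟨fun q => inr f g q.2, by fun_prop⟩
    ⟨fun q => moveStrip f g h' h₁'
      ((1 - q.1) * max (-2 * q.2.1) (4 * q.2.1 - 3) + q.1 * q.2.1, q.2.2), by fun_prop⟩
    ?_ ?_ (fun _ => rfl) (fun _ => rfl) (fun _ => rfl) (fun _ => rfl) ?_ ?_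
  · intro s hs w
    simp [moveStrip_of_nonneg]
  · intro s hs w
    norm_num [moveStrip_of_nonneg]
  · intro t ht w
    obtain ⟨ht0, ht1⟩ := ht
    simp only [coe_mk, sub_zero, one_mul, zero_mul, add_zero, ContinuousMap.comp_apply]
    rw [moveLeft_line _ _ ⟨ht0, ht1⟩]
    rcases le_total t (1 / 2) with h2 | h2
    · rw [max_eq_left (by linarith), moveStrip_of_nonpos (by linarith),
        moveStrip_of_nonpos (by linarith)]
      simp only [moveLeft, descLine_inl, hh]
      ring_nf
    · rw [max_eq_right (by linarith), moveStrip_of_nonneg (f' := f') (by linarith),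
        moveLeft_line _ _ ⟨by linarith, by linarith⟩]
      ring_nf
  · intro t ht w
    simp [moveStrip_of_nonneg ht.1]

theorem isHEquiv_moveLeft {h : C(ℝ × W, A)} (h₀ : ∀ w, h (0, w) = f w)
    (h₁ : ∀ w, h (1, w) = f' w) : IsHEquiv (moveLeft f f' g h h₀ h₁) := by
  let h' : C(ℝ × W, A) := ⟨fun q => h (1 - q.1, q.2), by fun_prop⟩
  exact ⟨_, moveLeft_comp_reverse (h' := h') h₀ h₁ fun _ _ => rfl,
    moveLeft_comp_reverse (h := h') _ _ fun t w => by simp [h']⟩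

/-- The map of homotopy pushouts induced by a map of left legs. -/
noncomputable def mapLeft (f : C(W, A)) (g : C(W, B)) (α : C(A, A')) (f' : C(W, A'))
    (hf : ∀ w, α (f w) = f' w) : C(HPushout f g, HPushout f' g) :=
  descLine ((inl f' g).comp α) (inr f' g) (line f' g) (by simp [hf]) (by simp)

theorem mapLeft_line {α : C(A, A')} {f' : C(W, A')} (hf : ∀ w, α (f w) = f' w) {t : ℝ}
    (ht : t ∈ I) (w : W) : mapLeft f g α f' hf (line f g (t, w)) = line f' g (t, w) :=
  descLine_line _ _ _ _ _ ht w

/-- Sliding the left leg along the homotopy `θ` from the identity to `α` deforms `moveLeft` into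
`mapLeft`: at time `s` only the part `[s - 1, 1]` of the strip is still traversed. -/
theorem isHEquiv_mapLeft_of_homotopic_id {α : C(A, A)} (hα : α.Homotopic (.id A))
    (hf : ∀ w, α (f w) = f' w) : IsHEquiv (mapLeft f g α f' hf) := by
  obtain ⟨θ, hθ₀, hθ₁⟩ := exists_real_homotopy hα.symm
  let h : C(ℝ × W, A) := ⟨fun q => θ (q.1, f q.2), by fun_prop⟩
  have h₀ : ∀ w, h (0, w) = f w := fun w => hθ₀ _
  have h₁ : ∀ w, h (1, w) = f' w := fun w => (hθ₁ _).trans (hf w)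
  refine (isHEquiv_moveLeft (g := g) h₀ h₁).of_homotopic ?_
  refine homotopic_of ⟨fun q => inl f' g (θ q), by fun_prop⟩ ⟨fun q => inr f' g q.2, by fun_prop⟩
    ⟨fun q => moveStrip f' g h h₁ (q.1 - 1 + q.2.1 * (2 - q.1), q.2.2), by fun_prop⟩
    ?_ ?_ ?_ ?_ (fun _ => rfl) (fun _ => rfl) ?_ ?_
  · intro s hs w
    simp only [coe_mk, zero_mul, add_zero]
    rw [moveStrip_of_nonpos (by linarith [hs.2])]
    simp [h]
  · intro s hs w
    simp only [coe_mk, one_mul]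
    rw [moveStrip_of_nonneg (by linarith [hs.2]), show s - 1 + (2 - s) = 1 by ring, line_one]
  · intro a
    simp [hθ₀, moveLeft]
  · intro a
    simp [hθ₁, mapLeft]
  · intro t ht w
    rw [moveLeft_line _ _ ht]
    simp only [coe_mk]
    ring_nf
  · intro t ht w
    rw [mapLeft_line _ ht]
    simp only [coe_mk]
    rw [show (1 : ℝ) - 1 + t * (2 - 1) = t by ring, moveStrip_of_nonneg ht.1]

theorem mapLeft_comp {A'' : Type*} [TopologicalSpace A''] {α : C(A, A')} {β : C(A', A'')}
    {f' : C(W, A')} {f'' : C(W, A'')} (hα : ∀ w, α (f w) = f' w) (hβ : ∀ w, β (f' w) = f'' w) :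
    (mapLeft f' g β f'' hβ).comp (mapLeft f g α f' hα) =
      mapLeft f g (β.comp α) f'' fun w => (congrArg β (hα w)).trans (hβ w) := by
  refine hom_ext (fun _ => rfl) (fun _ => rfl) fun t ht w => ?_
  rw [ContinuousMap.comp_apply, mapLeft_line _ ht, mapLeft_line _ ht, mapLeft_line _ ht]

/-- In the sequence of maps induced by `α`, `β`, `α`, both composites of neighbours are induced by
maps homotopic to the identity. Two-out-of-six then applies, and no coherence between the two
homotopies is needed. -/
theorem isHEquiv_mapLeft {α : C(A, A')} {f' : C(W, A')} (hα : IsHEquiv α)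
    (hf : ∀ w, α (f w) = f' w) : IsHEquiv (mapLeft f g α f' hf) := by
  obtain ⟨β, hβ, hβ'⟩ := hα
  have h₁ : IsHEquiv ((mapLeft f' g β (β.comp f') fun _ => rfl).comp (mapLeft f g α f' hf)) := by
    rw [mapLeft_comp]
    exact isHEquiv_mapLeft_of_homotopic_id hβ _
  have h₂ : IsHEquiv ((mapLeft (β.comp f') g α (α.comp (β.comp f')) fun _ => rfl).comp
      (mapLeft f' g β (β.comp f') fun _ => rfl)) := by
    rw [mapLeft_comp]
    exact isHEquiv_mapLeft_of_homotopic_id hβ' _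
  exact (IsHEquiv.two_of_six h₁ h₂).of_comp_left h₁

end move

/-- The symmetry of the homotopy pushout. -/
noncomputable def swap (f : C(W, A)) (g : C(W, B)) : C(HPushout f g, HPushout g f) :=
  descLine (inr g f) (inl g f) ⟨fun q => line g f (1 - q.1, q.2), by fun_prop⟩ (by simp) (by simp)

theorem swap_line {f : C(W, A)} {g : C(W, B)} {t : ℝ} (ht : t ∈ I) (w : W) :
    swap f g (line f g (t, w)) = line g f (1 - t, w) :=
  descLine_line _ _ _ _ _ ht w

theorem swap_swap (f : C(W, A)) (g : C(W, B)) (x : HPushout f g) : swap g f (swap f g x) = x := by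
  refine DFunLike.congr_fun (hom_ext (φ := (swap g f).comp (swap f g)) (ψ := .id _)
    (fun _ => rfl) (fun _ => rfl) fun t ht w => ?_) x
  rw [ContinuousMap.comp_apply, swap_line ht, swap_line ⟨by linarith [ht.2], by linarith [ht.1]⟩]
  simp

theorem isHEquiv_swap (f : C(W, A)) (g : C(W, B)) : IsHEquiv (swap f g) :=
  isHEquiv_of_inverse _ (swap g f) (swap_swap f g) (swap_swap g f)

section right

variable {f : C(W, A)} {g g' : C(W, B)}

/-- The case of left legs is conjugated with the symmetry. The equations on the legs are strict;
they are what later identifies the restriction of an equivalence to a vertex. -/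
theorem exists_moveRight (h : g.Homotopic g') : ∃ Θ : C(HPushout f g, HPushout f g'),
    IsHEquiv Θ ∧ (∀ a, Θ (inl f g a) = inl f g' a) ∧ ∀ b, Θ (inr f g b) = inr f g' b := by
  obtain ⟨h, h₀, h₁⟩ := exists_real_homotopy h
  exact ⟨(swap g' f).comp ((moveLeft g g' f h h₀ h₁).comp (swap f g)),
    (isHEquiv_swap _ _).comp ((isHEquiv_moveLeft _ _).comp (isHEquiv_swap _ _)),
    fun _ => rfl, fun _ => rfl⟩

theorem exists_mapRight {β : C(B, B')} {g' : C(W, B')} (hβ : IsHEquiv β)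
    (hg : ∀ w, β (g w) = g' w) : ∃ Θ : C(HPushout f g, HPushout f g'),
    IsHEquiv Θ ∧ (∀ a, Θ (inl f g a) = inl f g' a) ∧ ∀ b, Θ (inr f g b) = inr f g' (β b) :=
  ⟨(swap g' f).comp ((mapLeft g f β g' hg).comp (swap f g)),
    (isHEquiv_swap _ _).comp ((isHEquiv_mapLeft hβ _).comp (isHEquiv_swap _ _)),
    fun _ => rfl, fun _ => rfl⟩

/-- For the identity this is the retraction of a mapping cylinder onto its end; `mapLeft` carries
the identity to a general `f`. -/
theorem isHEquiv_inr {f : C(W, A)} (hf : IsHEquiv f) : IsHEquiv (inr f g) := by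
  have h : IsHEquiv (inr (.id W) g) := by
    let ρ : C(HPushout (.id W) g, B) :=
      descLine g (.id B) ⟨fun q => g q.2, by fun_prop⟩ (fun _ => rfl) (fun _ => rfl)
    refine ⟨ρ, .refl _, ?_⟩
    refine Homotopic.symm (homotopic_of (line _ g) ⟨fun q => inr _ g q.2, by fun_prop⟩
      ⟨fun q => line _ g (q.1 + (1 - q.1) * q.2.1, q.2.2), by fun_prop⟩ ?_ ?_ ?_ ?_ ?_ ?_ ?_ ?_)
    · intro s hs w
      simp
    · intro s hs w
      simp
    · intro a
      simp
    · intro a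
      exact line_one a
    · intro a
      rfl
    · intro a
      rfl
    · intro t ht w
      simp
    · intro t ht w
      have : ρ (line _ _ (t, w)) = g w := descLine_line _ _ _ _ _ ht w
      simp [this]
  exact (isHEquiv_mapLeft (f := .id W) (g := g) hf fun _ => rfl).comp h

end right

section paste

variable {W' : Type*} [TopologicalSpace W']

/-- The concatenation of two cylinders in an iterated homotopy pushout. -/
noncomputable def pasteStrip (f : C(W, A)) (ω : C(W', W)) (γ : C(W', B)) :
    C(ℝ × W', HPushout f (inl ω γ)) :=
  glueZero ⟨fun q => line f (inl ω γ) (1 + q.1, ω q.2), by fun_prop⟩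
    ⟨fun q => inr f (inl ω γ) (line ω γ q), by fun_prop⟩ (by simp)

variable {f : C(W, A)} {ω : C(W', W)} {γ : C(W', B)}

theorem pasteStrip_of_nonpos {t : ℝ} (ht : t ≤ 0) (w : W') :
    pasteStrip f ω γ (t, w) = line f (inl ω γ) (1 + t, ω w) :=
  glueZero_of_nonpos ht

theorem pasteStrip_of_nonneg {t : ℝ} (ht : 0 ≤ t) (w : W') :
    pasteStrip f ω γ (t, w) = inr f (inl ω γ) (line ω γ (t, w)) :=
  glueZero_of_nonneg ht

/-- The comparison map between a homotopy pushout and an iterated homotopy pushout. -/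
noncomputable def paste (f : C(W, A)) (ω : C(W', W)) (γ : C(W', B)) :
    C(HPushout (f.comp ω) γ, HPushout f (inl ω γ)) :=
  descLine (inl _ _) ((inr _ _).comp (inr _ _))
    ⟨fun q => pasteStrip f ω γ (2 * q.1 - 1, q.2), by fun_prop⟩
    (by intro w; simp [pasteStrip_of_nonpos])
    (by intro w; norm_num [pasteStrip_of_nonneg])

theorem paste_line {t : ℝ} (ht : t ∈ I) (w : W') :
    paste f ω γ (line _ _ (t, w)) = pasteStrip f ω γ (2 * t - 1, w) :=
  descLine_line _ _ _ _ _ ht w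

/-- The inverse `τ` collapses the outer cylinder onto its left end. Both homotopies then only
reparametrize the concatenated cylinders. -/
theorem isHEquiv_paste (f : C(W, A)) (ω : C(W', W)) (γ : C(W', B)) :
    IsHEquiv (paste f ω γ) := by
  let ρ : C(HPushout ω γ, HPushout (f.comp ω) γ) :=
    descLine ((inl _ _).comp f) (inr _ _) (line _ _) (by simp) (by simp)
  let τ : C(HPushout f (inl ω γ), HPushout (f.comp ω) γ) :=
    descLine (inl _ _) ρ ⟨fun q => inl _ _ (f q.2), by fun_prop⟩ (fun _ => rfl) (fun _ => rfl)
  have hτ {t : ℝ} (ht : t ∈ I) (w : W) : τ (line _ _ (t, w)) = inl _ _ (f w) :=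
    descLine_line _ _ _ _ _ ht w
  have hρ {t : ℝ} (ht : t ∈ I) (w : W') : ρ (line _ _ (t, w)) = line _ _ (t, w) :=
    descLine_line _ _ _ _ _ ht w
  refine ⟨τ, ?_, ?_⟩
  · refine homotopic_of ⟨fun q => inl _ _ q.2, by fun_prop⟩ ⟨fun q => inr _ _ q.2, by fun_prop⟩
      ⟨fun q => line (f.comp ω) γ ((1 - q.1) * max 0 (2 * q.2.1 - 1) + q.1 * q.2.1, q.2.2),
        by fun_prop⟩ ?_ ?_ (fun _ => rfl) (fun _ => rfl) (fun _ => rfl) (fun _ => rfl) ?_ ?_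
    · intro s hs w
      simp
    · intro s hs w
      norm_num
    · intro t ht w
      rw [ContinuousMap.comp_apply, paste_line ht]
      obtain ⟨ht0, ht1⟩ := ht
      rcases le_total (2 * t - 1) 0 with h | h
      · rw [pasteStrip_of_nonpos h, hτ ⟨by linarith, by linarith⟩]
        simp [max_eq_left h]
      · rw [pasteStrip_of_nonneg h]
        refine Eq.trans ?_ (hρ (t := 2 * t - 1) ⟨h, by linarith⟩ w).symm
        simp [max_eq_right h]
    · intro t ht w
      simp
  -- The image of `W` in the right vertex has to slide along the outer cylinder, from its left end
  -- at time 0 to its right end at time 1. The clamp `min q.1 1` keeps the gluing conditions valid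
  -- for all real times, as `descFamily` requires.
  · let Hb : C(ℝ × HPushout ω γ, HPushout f (inl ω γ)) := descFamily
      (line f (inl ω γ)) ⟨fun q => inr _ _ (inr _ _ q.2), by fun_prop⟩
      ⟨fun q => pasteStrip f ω γ (min q.1 1 - 1 + q.2.1 * (2 - min q.1 1), q.2.2), by fun_prop⟩
      (by
        intro s w
        have : min s 1 ≤ 1 := min_le_right _ _
        simp only [coe_mk, zero_mul, add_zero]
        rw [pasteStrip_of_nonpos (by linarith)]
        rcases le_total s 1 with h | h
        · simp [min_eq_left h]
        · simp only [min_eq_right h, line_of_one_le h]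
          norm_num)
      (by
        intro s w
        simp only [coe_mk, one_mul]
        rw [pasteStrip_of_nonneg (by linarith)]
        ring_nf
        simp)
    refine homotopic_of ⟨fun q => inl _ _ q.2, by fun_prop⟩ Hb
      ⟨fun q => line f (inl ω γ) (q.1 * q.2.1, q.2.2), by fun_prop⟩ ?_ ?_ (fun _ => rfl)
      (fun _ => rfl) ?_ ?_ ?_ ?_
    · intro s hs w
      simp
    · intro s hs w
      simp [Hb]
    · refine ind ?_ ?_ ?_
      · intro w
        exact line_zero _
      · intro b
        rfl
      · intro t ht w
        refine (descFamily_line _ _ _ _ _ _ ht w).trans ?_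
        refine Eq.trans ?_ (congrArg (paste f ω γ) (hρ ht w)).symm
        rw [paste_line ht]
        simp only [coe_mk]
        norm_num
        ring_nf
    · refine ind ?_ ?_ ?_
      · intro w
        exact line_one _
      · intro b
        rfl
      · intro t ht w
        refine (descFamily_line _ _ _ _ _ _ ht w).trans ?_
        simp only [coe_mk, ContinuousMap.id_apply]
        rw [← pasteStrip_of_nonneg ht.1]
        norm_num
    · intro t ht w
      rw [ContinuousMap.comp_apply, hτ ht]
      simp [paste]
    · intro t ht w
      simp

end paste

section invariance

variable {W' : Type*} [TopologicalSpace W']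

/-- By pasting, the left side is an iterated pushout with right vertex `HPushout ω (g.comp ω)`. This
vertex projects to `B` by an equivalence because `ω` is one. -/
theorem exists_precomp {ω : C(W', W)} (hω : IsHEquiv ω) (f : C(W, A)) (g : C(W, B)) :
    ∃ Θ : C(HPushout (f.comp ω) (g.comp ω), HPushout f g), IsHEquiv Θ ∧
      (∀ a, Θ (inl _ _ a) = inl f g a) ∧ ∀ b, Θ (inr _ _ b) = inr f g b := by
  let ρ : C(HPushout ω (g.comp ω), B) :=
    descLine g (.id B) ⟨fun q => g (ω q.2), by fun_prop⟩ (fun _ => rfl) (fun _ => rfl)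
  have hρ : IsHEquiv ρ := (isHEquiv_inr (g := g.comp ω) hω).of_comp_right isHEquiv_id
  obtain ⟨Θ, h, hl, hr⟩ := exists_mapRight (f := f) (g := inl ω (g.comp ω)) (g' := g) hρ
    fun _ => rfl
  exact ⟨Θ.comp (paste f ω (g.comp ω)), h.comp (isHEquiv_paste _ _ _), hl,
    fun b => hr (inr _ _ b)⟩

/-- Homotopy invariance of the homotopy pushout. -/
theorem exists_map {f : C(W, A)} {g : C(W, B)} {f' : C(W', A')} {g' : C(W', B')} {α : C(A, A')}
    {β : C(B, B')} {ω : C(W, W')} (hα : IsHEquiv α) (hβ : IsHEquiv β) (hω : IsHEquiv ω)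
    (hf : (α.comp f).Homotopic (f'.comp ω)) (hg : (β.comp g).Homotopic (g'.comp ω)) :
    ∃ Θ : C(HPushout f g, HPushout f' g'), IsHEquiv Θ ∧
      (∀ a, Θ (inl f g a) = inl f' g' (α a)) ∧ ∀ b, Θ (inr f g b) = inr f' g' (β b) := by
  obtain ⟨h, h₀, h₁⟩ := exists_real_homotopy hf
  obtain ⟨Θ₁, i₁, l₁, r₁⟩ := exists_mapRight (f := f'.comp ω) hβ (g := g) (g' := β.comp g) fun _ => rfl
  obtain ⟨Θ₂, i₂, l₂, r₂⟩ := exists_moveRight (f := f'.comp ω) hg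
  obtain ⟨Θ₃, i₃, l₃, r₃⟩ := exists_precomp hω f' g'
  refine ⟨Θ₃.comp (Θ₂.comp (Θ₁.comp ((moveLeft (α.comp f) (f'.comp ω) g h h₀ h₁).comp
    (mapLeft f g α (α.comp f) fun _ => rfl)))), i₃.comp (i₂.comp (i₁.comp
    ((isHEquiv_moveLeft h₀ h₁).comp (isHEquiv_mapLeft hα _)))), fun a => ?_, fun b => ?_⟩
  · change Θ₃ (Θ₂ (Θ₁ (inl _ _ (α a)))) = _
    rw [l₁]
    exact (congrArg Θ₃ (l₂ _)).trans (l₃ _)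
  · change Θ₃ (Θ₂ (Θ₁ (inr _ _ b))) = _
    rw [r₁]
    exact (congrArg Θ₃ (r₂ _)).trans (r₃ _)

end invariance

end HPushout

/-! ### Homotopy invariance of homotopy pullbacks -/

namespace HPullback

variable {A A' B C : Type u} [TopologicalSpace A] [TopologicalSpace A'] [TopologicalSpace B]
  [TopologicalSpace C] {Y : Type*} [TopologicalSpace Y]

/-- The path component of a point of the homotopy pullback, extended constantly to `ℝ`. -/
noncomputable def path (f : C(A, C)) (g : C(B, C)) : C(ℝ × HPullback f g, C) where
  toFun q := q.2.1.2.1 (Set.projIcc 0 1 zero_le_one q.1)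
  continuous_toFun := by
    have h : Continuous fun q : ℝ × HPullback f g => q.2.1.2.1 :=
      continuous_fst.comp (continuous_snd.comp (continuous_subtype_val.comp continuous_snd))
    exact h.eval (by fun_prop)

variable {f f' : C(A, C)} {g : C(B, C)}

theorem path_of_le_zero {t : ℝ} (ht : t ≤ 0) (x : HPullback f g) :
    path f g (t, x) = f (fst f g x) := by
  have : Set.projIcc (0 : ℝ) 1 zero_le_one t = 0 := Set.projIcc_of_le_left _ ht
  exact (congrArg x.1.2.1 this).trans x.2.1

theorem path_of_one_le {t : ℝ} (ht : 1 ≤ t) (x : HPullback f g) :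
    path f g (t, x) = g (snd f g x) := by
  have : Set.projIcc (0 : ℝ) 1 zero_le_one t = 1 := Set.projIcc_of_right_le _ ht
  exact (congrArg x.1.2.1 this).trans x.2.2

@[simp] theorem path_zero (x : HPullback f g) : path f g (0, x) = f (fst f g x) :=
  path_of_le_zero le_rfl x

@[simp] theorem path_one (x : HPullback f g) : path f g (1, x) = g (snd f g x) :=
  path_of_one_le le_rfl x

theorem path_coe (t : I) (x : HPullback f g) : path f g (t, x) = x.1.2.1 t := by
  change x.1.2.1 _ = _
  simp

theorem ext {x y : HPullback f g} (h₁ : fst f g x = fst f g y) (h₂ : snd f g x = snd f g y)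
    (h : ∀ t ∈ I, path f g (t, x) = path f g (t, y)) : x = y := by
  refine Subtype.ext (Prod.ext h₁ (Prod.ext (ContinuousMap.ext fun t => ?_) h₂))
  rw [← path_coe, ← path_coe]
  exact h t t.2

/-- The map into a homotopy pullback given by a homotopy parametrized by the real line. -/
def lift (a : C(Y, A)) (b : C(Y, B)) (h : C(ℝ × Y, C)) (h₀ : ∀ y, h (0, y) = f (a y))
    (h₁ : ∀ y, h (1, y) = g (b y)) : C(Y, HPullback f g) where
  toFun y := ⟨(a y, ⟨fun t => h (t, y), by fun_prop⟩, b y),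
    (congrArg (fun s => h (s, y)) (by simp)).trans (h₀ y),
    (congrArg (fun s => h (s, y)) (by simp)).trans (h₁ y)⟩
  continuous_toFun := by
    refine Continuous.subtype_mk (a.continuous.prodMk (Continuous.prodMk ?_ b.continuous)) _
    exact ContinuousMap.continuous_of_continuous_uncurry _ (by
      change Continuous fun q : Y × I => h (q.2, q.1)
      fun_prop)

section lift

variable (a : C(Y, A)) (b : C(Y, B)) (h : C(ℝ × Y, C)) (h₀ : ∀ y, h (0, y) = f (a y))
  (h₁ : ∀ y, h (1, y) = g (b y))

@[simp] theorem fst_lift (y : Y) : fst f g (lift a b h h₀ h₁ y) = a y := rfl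

theorem path_lift {t : ℝ} (ht : t ∈ I) (y : Y) :
    path f g (t, lift a b h h₀ h₁ y) = h (t, y) := by
  lift t to I using ht
  rw [path_coe]
  rfl

end lift

/-- Two maps into a homotopy pullback are homotopic if their components are so, compatibly. The
parameters are the time, the parameter of the path and the point. -/
theorem homotopic_of {φ ψ : C(Y, HPullback f g)} (Ha : C(ℝ × Y, A)) (Hb : C(ℝ × Y, B))
    (Hc : C(ℝ × ℝ × Y, C)) (hf : ∀ s ∈ I, ∀ y, Hc (s, 0, y) = f (Ha (s, y)))
    (hg : ∀ s ∈ I, ∀ y, Hc (s, 1, y) = g (Hb (s, y)))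
    (ha₀ : ∀ y, Ha (0, y) = fst f g (φ y)) (ha₁ : ∀ y, Ha (1, y) = fst f g (ψ y))
    (hb₀ : ∀ y, Hb (0, y) = snd f g (φ y)) (hb₁ : ∀ y, Hb (1, y) = snd f g (ψ y))
    (hc₀ : ∀ t ∈ I, ∀ y, Hc (0, t, y) = path f g (t, φ y))
    (hc₁ : ∀ t ∈ I, ∀ y, Hc (1, t, y) = path f g (t, ψ y)) : φ.Homotopic ψ := by
  let K : C(I × Y, HPullback f g) :=
    lift ⟨fun q : I × Y => Ha (q.1, q.2), by fun_prop⟩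
      ⟨fun q : I × Y => Hb (q.1, q.2), by fun_prop⟩
      ⟨fun q : ℝ × I × Y => Hc (q.2.1, q.1, q.2.2), by fun_prop⟩
      (fun q => hf q.1 q.1.2 q.2) (fun q => hg q.1 q.1.2 q.2)
  refine ⟨{ toContinuousMap := K, map_zero_left := fun y => ?_, map_one_left := fun y => ?_ }⟩
  · refine ext (ha₀ y) (hb₀ y) fun t ht => ?_
    rw [← hc₀ t ht y]
    exact path_lift _ _ _ _ _ ht _
  · refine ext (ha₁ y) (hb₁ y) fun t ht => ?_
    rw [← hc₁ t ht y]
    exact path_lift _ _ _ _ _ ht _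

/-- The homotopy `h` in reverse direction for parameters in `[-1, 0]`, followed by the path of a
point of the homotopy pullback for parameters in `[0, 1]`. -/
noncomputable def moveStrip (f : C(A, C)) (g : C(B, C)) (h : C(ℝ × A, C))
    (h₀ : ∀ a, h (0, a) = f a) : C(ℝ × HPullback f g, C) :=
  glueZero ⟨fun q => h (-q.1, fst f g q.2), by fun_prop⟩ (path f g) (by simp [h₀])

theorem moveStrip_of_nonpos {h : C(ℝ × A, C)} {h₀ : ∀ a, h (0, a) = f a} {t : ℝ} (ht : t ≤ 0)
    (x : HPullback f g) : moveStrip f g h h₀ (t, x) = h (-t, fst f g x) :=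
  glueZero_of_nonpos ht

theorem moveStrip_of_nonneg {h : C(ℝ × A, C)} {h₀ : ∀ a, h (0, a) = f a} {t : ℝ} (ht : 0 ≤ t)
    (x : HPullback f g) : moveStrip f g h h₀ (t, x) = path f g (t, x) :=
  glueZero_of_nonneg ht

/-- The map of homotopy pullbacks induced by a homotopy of left legs. -/
noncomputable def moveLeft (f f' : C(A, C)) (g : C(B, C)) (h : C(ℝ × A, C))
    (h₀ : ∀ a, h (0, a) = f a) (h₁ : ∀ a, h (1, a) = f' a) : C(HPullback f g, HPullback f' g) :=
  lift (fst f g) (snd f g) ⟨fun q => moveStrip f g h h₀ (2 * q.1 - 1, q.2), by fun_prop⟩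
    (by intro w; simp [moveStrip_of_nonpos, h₁])
    (by intro w; norm_num [moveStrip_of_nonneg])

theorem path_moveLeft {h : C(ℝ × A, C)} (h₀ : ∀ a, h (0, a) = f a) (h₁ : ∀ a, h (1, a) = f' a)
    {t : ℝ} (ht : t ∈ I) (x : HPullback f g) :
    path f' g (t, moveLeft f f' g h h₀ h₁ x) = moveStrip f g h h₀ (2 * t - 1, x) :=
  path_lift _ _ _ _ _ ht x

/-- Dual to the case of pushouts: the composite goes along `h` and back before it follows the given
path, with the same piecewise linear parameter. -/
theorem moveLeft_comp_reverse {h h' : C(ℝ × A, C)} (h₀ : ∀ a, h (0, a) = f a)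
    (h₁ : ∀ a, h (1, a) = f' a) (hh : ∀ t a, h' (t, a) = h (1 - t, a)) :
    ((moveLeft f' f g h' (by simp [hh, h₁]) (by simp [hh, h₀])).comp
      (moveLeft f f' g h h₀ h₁)).Homotopic (.id _) := by
  refine homotopic_of ⟨fun q => fst f g q.2, by fun_prop⟩ ⟨fun q => snd f g q.2, by fun_prop⟩
    ⟨fun q => moveStrip f g h h₀
      ((1 - q.1) * max (-2 * q.2.1) (4 * q.2.1 - 3) + q.1 * q.2.1, q.2.2), by fun_prop⟩
    ?_ ?_ (fun _ => rfl) (fun _ => rfl) (fun _ => rfl) (fun _ => rfl) ?_ ?_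
  · intro s hs w
    simp [moveStrip_of_nonneg]
  · intro s hs w
    norm_num [moveStrip_of_nonneg]
  · intro t ht w
    rw [ContinuousMap.comp_apply, path_moveLeft _ _ ht]
    obtain ⟨ht0, ht1⟩ := ht
    simp only [coe_mk, sub_zero, one_mul, zero_mul, add_zero]
    rcases le_total t (1 / 2) with h2 | h2
    · rw [max_eq_left (by linarith), moveStrip_of_nonpos (by linarith),
        moveStrip_of_nonpos (by linarith)]
      simp only [moveLeft, fst_lift, hh]
      ring_nf
    · rw [max_eq_right (by linarith), moveStrip_of_nonneg (f := f') (by linarith),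
        path_moveLeft _ _ ⟨by linarith, by linarith⟩]
      ring_nf
  · intro t ht w
    simp [moveStrip_of_nonneg ht.1]

theorem isHEquiv_moveLeft {h : C(ℝ × A, C)} (h₀ : ∀ a, h (0, a) = f a)
    (h₁ : ∀ a, h (1, a) = f' a) : IsHEquiv (moveLeft f f' g h h₀ h₁) := by
  let h' : C(ℝ × A, C) := ⟨fun q => h (1 - q.1, q.2), by fun_prop⟩
  exact ⟨_, moveLeft_comp_reverse (h' := h') h₀ h₁ fun _ _ => rfl,
    moveLeft_comp_reverse (h := h') _ _ fun t w => by simp [h']⟩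

/-- The map of homotopy pullbacks induced by a map of left legs. -/
noncomputable def mapLeft (f : C(A, C)) (g : C(B, C)) (α : C(A', A)) (f' : C(A', C))
    (hf : ∀ a, f (α a) = f' a) : C(HPullback f' g, HPullback f g) :=
  lift (α.comp (fst f' g)) (snd f' g) (path f' g) (by simp [hf]) (by simp)

theorem path_mapLeft {α : C(A', A)} {f' : C(A', C)} (hf : ∀ a, f (α a) = f' a) {t : ℝ}
    (ht : t ∈ I) (x : HPullback f' g) : path f g (t, mapLeft f g α f' hf x) = path f' g (t, x) :=
  path_lift _ _ _ _ _ ht x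

/-- At time `s` the detour of `moveLeft` along `h` is cut down to the parameters `[s - 1, 0]`, while
the point of `A` moves along `θ` to `θ (1 - s)`. -/
theorem isHEquiv_mapLeft_of_homotopic_id {α : C(A, A)} (hα : α.Homotopic (.id A))
    (hf : ∀ a, f (α a) = f' a) : IsHEquiv (mapLeft f g α f' hf) := by
  obtain ⟨θ, hθ₀, hθ₁⟩ := exists_real_homotopy hα
  let h : C(ℝ × A, C) := f.comp θ
  have h₀ : ∀ a, h (0, a) = f' a := fun a => (congrArg f (hθ₀ a)).trans (hf a)
  have h₁ : ∀ a, h (1, a) = f a := fun a => congrArg f (hθ₁ a)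
  refine (isHEquiv_moveLeft (g := g) h₀ h₁).of_homotopic ?_
  refine homotopic_of ⟨fun q => θ (1 - q.1, fst f' g q.2), by fun_prop⟩
    ⟨fun q => snd f' g q.2, by fun_prop⟩
    ⟨fun q => moveStrip f' g h h₀ (q.1 - 1 + q.2.1 * (2 - q.1), q.2.2), by fun_prop⟩
    ?_ ?_ ?_ ?_ (fun _ => rfl) (fun _ => rfl) ?_ ?_
  · intro s hs w
    simp only [coe_mk, zero_mul, add_zero]
    rw [moveStrip_of_nonpos (by linarith [hs.2])]
    simp [h]
  · intro s hs w
    simp only [coe_mk, one_mul]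
    rw [moveStrip_of_nonneg (by linarith [hs.2]), show s - 1 + (2 - s) = 1 by ring, path_one]
  · intro a
    simp [hθ₁, moveLeft]
  · intro a
    simp [hθ₀, mapLeft]
  · intro t ht w
    rw [path_moveLeft _ _ ht]
    simp only [coe_mk]
    ring_nf
  · intro t ht w
    rw [path_mapLeft _ ht]
    simp only [coe_mk]
    rw [show (1 : ℝ) - 1 + t * (2 - 1) = t by ring, moveStrip_of_nonneg ht.1]

theorem mapLeft_comp {A'' : Type u} [TopologicalSpace A''] {α : C(A', A)} {β : C(A'', A')}
    {f' : C(A', C)} {f'' : C(A'', C)} (hα : ∀ a, f (α a) = f' a) (hβ : ∀ a, f' (β a) = f'' a) :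
    (mapLeft f g α f' hα).comp (mapLeft f' g β f'' hβ) =
      mapLeft f g (α.comp β) f'' fun a => (hα (β a)).trans (hβ a) := by
  refine ContinuousMap.ext fun x => ext rfl rfl fun t ht => ?_
  rw [ContinuousMap.comp_apply, path_mapLeft _ ht, path_mapLeft _ ht, path_mapLeft _ ht]

theorem isHEquiv_mapLeft {α : C(A', A)} {f' : C(A', C)} (hα : IsHEquiv α)
    (hf : ∀ a, f (α a) = f' a) : IsHEquiv (mapLeft f g α f' hf) := by
  obtain ⟨β, hβ, hβ'⟩ := hα
  have h₁ : IsHEquiv ((mapLeft f g α f' hf).comp (mapLeft f' g β (f'.comp β) fun _ => rfl)) := by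
    rw [mapLeft_comp]
    exact isHEquiv_mapLeft_of_homotopic_id hβ' _
  have h₂ : IsHEquiv ((mapLeft f' g β (f'.comp β) fun _ => rfl).comp
      (mapLeft (f'.comp β) g α ((f'.comp β).comp α) fun _ => rfl)) := by
    rw [mapLeft_comp]
    exact isHEquiv_mapLeft_of_homotopic_id hβ _
  exact (IsHEquiv.two_of_six h₂ h₁).of_comp_right h₁

/-- Homotopy invariance of the homotopy pullback in one leg. -/
theorem exists_map {α : C(A', A)} {f' : C(A', C)} (hα : IsHEquiv α)
    (hf : f'.Homotopic (f.comp α)) (g : C(B, C)) :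
    ∃ Θ : C(HPullback f' g, HPullback f g), IsHEquiv Θ := by
  obtain ⟨h, h₀, h₁⟩ := exists_real_homotopy hf
  exact ⟨_, (isHEquiv_mapLeft (f := f) (g := g) hα fun _ => rfl).comp (isHEquiv_moveLeft h₀ h₁)⟩

end HPullback

/-! ### Heights, collars and closed pieces of the double mapping cylinder -/

namespace HPushout

variable {W A B Y : Type*} [TopologicalSpace W] [TopologicalSpace A] [TopologicalSpace B]
  [TopologicalSpace Y] (f : C(W, A)) (g : C(W, B))

/-- The height in the double mapping cylinder. -/
noncomputable def height : C(HPushout f g, ℝ) :=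
  descLine (.const _ 0) (.const _ 1) ⟨fun q => q.1, by fun_prop⟩ (fun _ => rfl) (fun _ => rfl)

/-- The deformation of the double mapping cylinder that collapses two collars. -/
noncomputable def stretch : C(I × HPushout f g, HPushout f g) :=
  descFamily ⟨fun q => inl f g q.2, by fun_prop⟩ ⟨fun q => inr f g q.2, by fun_prop⟩
    ⟨fun q => line f g ((1 - q.1) * q.2.1 + q.1 * (3 * q.2.1 - 1), q.2.2), by fun_prop⟩
    (fun s w => line_of_le_zero (by simpa using s.2.1) w)
    (fun s w => line_of_one_le (by linarith [s.2.1]) w)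

open Classical in
/-- The position of a point in the disjoint decomposition of the double mapping cylinder. -/
noncomputable def position : HPushout f g → A ⊕ W ⊕ B :=
  Quot.lift (Sum.elim .inl (Sum.elim
    (fun q => if q.1 = 0 then .inl (f q.2) else if q.1 = 1 then .inr (.inr (g q.2)) else
      .inr (.inl q.2)) (.inr ∘ .inr))) (by
    rintro _ _ (x | x)
    · simp
    · simp)

variable {f g}

theorem line_clamp (t : ℝ) (w : W) : line f g (max 0 (min t 1), w) = line f g (t, w) := by
  rcases le_total t 0 with h0 | h0
  · rw [min_eq_left (h0.trans zero_le_one), max_eq_left h0, line_of_le_zero h0, line_zero]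
  · rcases le_total t 1 with h1 | h1
    · rw [min_eq_left h1, max_eq_right h0]
    · rw [min_eq_right h1, max_eq_right zero_le_one, line_of_one_le h1, line_one]

@[simp] theorem height_inl (a : A) : height f g (inl f g a) = 0 := rfl

@[simp] theorem height_inr (b : B) : height f g (inr f g b) = 1 := rfl

theorem height_line {t : ℝ} (ht : t ∈ I) (w : W) : height f g (line f g (t, w)) = t :=
  descLine_line _ _ _ _ _ ht w

@[simp] theorem stretch_inl (s : I) (a : A) : stretch f g (s, inl f g a) = inl f g a := rfl

@[simp] theorem stretch_inr (s : I) (b : B) : stretch f g (s, inr f g b) = inr f g b := rfl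

theorem stretch_line (s : I) {t : ℝ} (ht : t ∈ I) (w : W) :
    stretch f g (s, line f g (t, w)) = line f g ((1 - s) * t + s * (3 * t - 1), w) :=
  descFamily_line _ _ _ _ _ s ht w

theorem stretch_one_line {t : ℝ} (ht : t ∈ I) (w : W) :
    stretch f g (1, line f g (t, w)) = line f g (3 * t - 1, w) := by
  simp [stretch_line 1 ht]

theorem stretch_zero (x : HPushout f g) : stretch f g (0, x) = x := by
  refine ind (p := fun x => stretch f g (0, x) = x) (fun _ => rfl) (fun _ => rfl) ?_ x
  intro t ht w
  simp [stretch_line 0 ht]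

theorem inl_injective : Function.Injective (inl f g) := fun _ _ h =>
  Sum.inl.inj (congrArg (position f g) h)

theorem inr_injective : Function.Injective (inr f g) := fun _ _ h =>
  Sum.inr.inj (Sum.inr.inj (congrArg (position f g) h))

theorem position_line {t : ℝ} (h₀ : 0 < t) (h₁ : t < 1) (w : W) :
    position f g (line f g (t, w)) = .inr (.inl w) := by
  lift t to I using ⟨h₀.le, h₁.le⟩
  rw [line_coe]
  have h₀' : t ≠ 0 := fun h => by simp [h] at h₀
  have h₁' : t ≠ 1 := fun h => by simp [h] at h₁
  simp [position, h₀', h₁']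

theorem line_injective {t : ℝ} (h₀ : 0 < t) (h₁ : t < 1) {w w' : W}
    (h : line f g (t, w) = line f g (t, w')) : w = w' := by
  have := congrArg (position f g) h
  simpa [position_line h₀ h₁] using this

/-- Induction that treats the two ends of the cylinder as parts of the legs. -/
theorem ind_Ioo {p : HPushout f g → Prop} (hl : ∀ a, p (inl f g a)) (hr : ∀ b, p (inr f g b))
    (hc : ∀ t ∈ Set.Ioo (0 : ℝ) 1, ∀ w, p (line f g (t, w))) (x : HPushout f g) : p x := by
  refine ind hl hr (fun t ht w => ?_) x
  rcases ht.1.eq_or_lt with rfl | h₀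
  · simpa using hl (f w)
  · rcases ht.2.eq_or_lt with rfl | h₁
    · simpa using hr (g w)
    · exact hc t ⟨h₀, h₁⟩ w

theorem isClosed_iff {s : Set (HPushout f g)} : IsClosed s ↔
    IsClosed (inl f g ⁻¹' s) ∧ IsClosed {q : I × W | line f g (q.1, q.2) ∈ s} ∧
      IsClosed (inr f g ⁻¹' s) := by
  have hq : Topology.IsQuotientMap (Quot.mk (PushoutRel f g)) := isQuotientMap_quot_mk
  refine hq.isClosed_preimage.symm.trans ?_
  rw [isClosed_sum_iff, isClosed_sum_iff]
  simp only [line_coe]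
  rfl

theorem line_eq_inl {t : ℝ} (ht : t ∈ I) {w : W} {a : A} (h : line f g (t, w) = inl f g a) :
    t = 0 ∧ f w = a := by
  have h0 : t = 0 := by simpa [height_line ht] using congrArg (height f g) h
  subst h0
  exact ⟨rfl, inl_injective (by simpa using h)⟩

theorem line_eq_inr {t : ℝ} (ht : t ∈ I) {w : W} {b : B} (h : line f g (t, w) = inr f g b) :
    t = 1 ∧ g w = b := by
  have h1 : t = 1 := by simpa [height_line ht] using congrArg (height f g) h
  subst h1
  exact ⟨rfl, inr_injective (by simpa using h)⟩

theorem inl_ne_inr (a : A) (b : B) : inl f g a ≠ inr f g b := fun h => by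
  simpa using congrArg (height f g) h

/-- The embeddings of the legs and of the middle of the cylinder allow a map with values in one of
these pieces to be corestricted continuously. The three pieces of the inverse in the descent theorem
arise in this way. -/
theorem isClosedEmbedding_inl : Topology.IsClosedEmbedding (inl f g) := by
  refine .of_continuous_injective_isClosedMap (inl f g).continuous inl_injective fun s hs => ?_
  refine isClosed_iff.2 ⟨?_, ?_, ?_⟩
  · rwa [Set.preimage_image_eq _ inl_injective]
  · have : {q : I × W | line f g (q.1, q.2) ∈ inl f g '' s} =
        {q : I × W | (q.1 : ℝ) = 0} ∩ {q : I × W | f q.2 ∈ s} := by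
      ext ⟨t, w⟩
      constructor
      · rintro ⟨a, ha, h⟩
        obtain ⟨h0, rfl⟩ := line_eq_inl t.2 h.symm
        exact ⟨h0, ha⟩
      · rintro ⟨h0, h⟩
        refine ⟨f w, h, ?_⟩
        change _ = line f g ((t : ℝ), w)
        rw [show (t : ℝ) = 0 from h0, line_zero]
    rw [this]
    exact (isClosed_eq (by fun_prop) (by fun_prop)).inter (hs.preimage (by fun_prop))
  · convert isClosed_empty
    ext b
    simpa using fun a _ => inl_ne_inr a b

theorem isClosedEmbedding_inr : Topology.IsClosedEmbedding (inr f g) := by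
  refine .of_continuous_injective_isClosedMap (inr f g).continuous inr_injective fun s hs => ?_
  refine isClosed_iff.2 ⟨?_, ?_, ?_⟩
  · convert isClosed_empty
    ext a
    simpa using fun b _ => (inl_ne_inr a b).symm
  · have : {q : I × W | line f g (q.1, q.2) ∈ inr f g '' s} =
        {q : I × W | (q.1 : ℝ) = 1} ∩ {q : I × W | g q.2 ∈ s} := by
      ext ⟨t, w⟩
      constructor
      · rintro ⟨a, ha, h⟩
        obtain ⟨h0, rfl⟩ := line_eq_inr t.2 h.symm
        exact ⟨h0, ha⟩
      · rintro ⟨h0, h⟩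
        refine ⟨g w, h, ?_⟩
        change _ = line f g ((t : ℝ), w)
        rw [show (t : ℝ) = 1 from h0, line_one]
    rw [this]
    exact (isClosed_eq (by fun_prop) (by fun_prop)).inter (hs.preimage (by fun_prop))
  · rwa [Set.preimage_image_eq _ inr_injective]

/-- Away from the glued ends the cylinder keeps its product topology. The range `[1/3, 2/3]` is the
one that `stretch` expands to the whole cylinder. -/
theorem isClosedEmbedding_line_middle : Topology.IsClosedEmbedding
    (fun q : Set.Icc (1 / 3 : ℝ) (2 / 3) × W => line f g (q.1, q.2)) := by
  have hI (t : Set.Icc (1 / 3 : ℝ) (2 / 3)) : (t : ℝ) ∈ I :=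
    ⟨by linarith [t.2.1], by linarith [t.2.2]⟩
  have inj : Function.Injective
      (fun q : Set.Icc (1 / 3 : ℝ) (2 / 3) × W => line f g (q.1, q.2)) := by
    rintro ⟨t, w⟩ ⟨t', w'⟩ h
    have ht : (t : ℝ) = t' := by
      simpa [height_line (hI t), height_line (hI t')] using congrArg (height f g) h
    obtain rfl : t = t' := Subtype.ext ht
    exact Prod.ext rfl (line_injective (by linarith [t.2.1]) (by linarith [t.2.2]) h)
  refine .of_continuous_injective_isClosedMap (by fun_prop) inj fun s hs => ?_
  refine isClosed_iff.2 ⟨?_, ?_, ?_⟩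
  · convert isClosed_empty
    refine Set.eq_empty_of_forall_notMem ?_
    rintro a ⟨⟨t, w⟩, -, h⟩
    have := (line_eq_inl (hI t) h).1
    linarith [t.2.1]
  · have he : Topology.IsInducing
        (fun q : Set.Icc (1 / 3 : ℝ) (2 / 3) × W => ((q.1 : ℝ), q.2)) :=
      Topology.IsInducing.subtypeVal.prodMap .id
    obtain ⟨s', hs', rfl⟩ := he.isClosed_iff.1 hs
    have : {q : I × W | line f g (q.1, q.2) ∈
        (fun q : Set.Icc (1 / 3 : ℝ) (2 / 3) × W => line f g (q.1, q.2)) ''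
          ((fun q : Set.Icc (1 / 3 : ℝ) (2 / 3) × W => ((q.1 : ℝ), q.2)) ⁻¹' s')} =
        {q : I × W | (q.1 : ℝ) ∈ Set.Icc (1 / 3 : ℝ) (2 / 3)} ∩
          {q : I × W | ((q.1 : ℝ), q.2) ∈ s'} := by
      ext ⟨t, w⟩
      constructor
      · rintro ⟨⟨t', w'⟩, hm, h⟩
        have ht : (t' : ℝ) = t := by
          simpa [height_line t.2, height_line (hI t')] using congrArg (height f g) h
        have h' : line f g ((t' : ℝ), w') = line f g ((t' : ℝ), w) := by rw [ht]; exact ht ▸ h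
        obtain rfl := line_injective (by linarith [t'.2.1]) (by linarith [t'.2.2]) h'
        refine ⟨?_, ?_⟩
        · change (t : ℝ) ∈ Set.Icc (1 / 3 : ℝ) (2 / 3)
          exact ht ▸ t'.2
        · change ((t : ℝ), w') ∈ s'
          exact ht ▸ hm
      · rintro ⟨ht, h⟩
        exact ⟨(⟨t, ht⟩, w), h, rfl⟩
    rw [this]
    exact (isClosed_Icc.preimage (by fun_prop)).inter (hs'.preimage (by fun_prop))
  · convert isClosed_empty
    refine Set.eq_empty_of_forall_notMem ?_
    rintro a ⟨⟨t, w⟩, -, h⟩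
    have := (line_eq_inr (hI t) h).1
    linarith [t.2.2]

theorem exists_continuous_factor {X E : Type*} [TopologicalSpace X] [TopologicalSpace E]
    {e : E → Y} (he : Topology.IsInducing e) (φ : C(X, Y)) (h : ∀ x, ∃ a, e a = φ x) :
    ∃ a : C(X, E), ∀ x, e (a x) = φ x := by
  choose a ha using h
  refine ⟨⟨a, he.continuous_iff.2 ?_⟩, ha⟩
  rw [show e ∘ a = φ from funext ha]
  exact φ.continuous

/-- At time 1 the height `t` becomes `3 t - 1`, clamped, so the collar `t ≤ 1/3` lands in the left
leg. -/
theorem exists_retract_left : ∃ a : C({x : HPushout f g // height f g x ≤ 1 / 3}, A),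
    ∀ x, inl f g (a x) = stretch f g (1, x) := by
  refine exists_continuous_factor isClosedEmbedding_inl.isInducing
    ((stretch f g).comp ⟨fun x : {x : HPushout f g // height f g x ≤ 1 / 3} => ((1 : I), x.1),
      by fun_prop⟩) ?_
  rintro ⟨x, hx⟩
  change ∃ a, inl f g a = stretch f g (1, x)
  revert hx
  refine ind (p := fun x => height f g x ≤ 1 / 3 → ∃ a, inl f g a = stretch f g (1, x))
    (fun a _ => ⟨a, rfl⟩) (fun b h => ?_) (fun t ht w h => ?_) x
  · norm_num at h
  · rw [height_line ht] at h
    exact ⟨f w, by rw [stretch_one_line ht, line_of_le_zero (by linarith)]⟩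

theorem exists_retract_right : ∃ b : C({x : HPushout f g // 2 / 3 ≤ height f g x}, B),
    ∀ x, inr f g (b x) = stretch f g (1, x) := by
  refine exists_continuous_factor isClosedEmbedding_inr.isInducing
    ((stretch f g).comp ⟨fun x : {x : HPushout f g // 2 / 3 ≤ height f g x} => ((1 : I), x.1),
      by fun_prop⟩) ?_
  rintro ⟨x, hx⟩
  change ∃ a, inr f g a = stretch f g (1, x)
  revert hx
  refine ind (p := fun x => 2 / 3 ≤ height f g x → ∃ a, inr f g a = stretch f g (1, x))
    (fun a h => ?_) (fun b _ => ⟨b, rfl⟩) (fun t ht w h => ?_) x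
  · norm_num at h
  · rw [height_line ht] at h
    exact ⟨g w, by rw [stretch_one_line ht, line_of_one_le (by linarith)]⟩

theorem exists_middle :
    ∃ c : C({x : HPushout f g // height f g x ∈ Set.Icc (1 / 3 : ℝ) (2 / 3)}, W),
      ∀ x, line f g (height f g x.1, c x) = x.1 := by
  obtain ⟨c, hc⟩ := exists_continuous_factor (isClosedEmbedding_line_middle (f := f)
    (g := g)).isInducing (⟨fun x => x.1, by fun_prop⟩ :
      C({x : HPushout f g // height f g x ∈ Set.Icc (1 / 3 : ℝ) (2 / 3)}, HPushout f g)) (by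
    rintro ⟨x, hx⟩
    revert hx
    refine ind (p := fun x => ∀ hx : height f g x ∈ Set.Icc (1 / 3 : ℝ) (2 / 3),
      ∃ q : Set.Icc (1 / 3 : ℝ) (2 / 3) × W, line f g (q.1, q.2) = x)
      (fun a h => ?_) (fun b h => ?_) (fun t ht w h => ?_) x
    · norm_num at h
    · norm_num at h
    · rw [height_line ht] at h
      exact ⟨(⟨t, h⟩, w), rfl⟩)
  refine ⟨⟨fun x => (c x).2, by fun_prop⟩, fun x => ?_⟩
  have hx : line f g ((c x).1, (c x).2) = x.1 := hc x
  have ht : height f g x.1 = (c x).1 := by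
    conv_lhs => rw [← hx]
    exact height_line ⟨by linarith [(c x).1.2.1], by linarith [(c x).1.2.2]⟩ _
  rw [ht]
  exact hx

end HPushout

/-! ### Descent: pullbacks commute with homotopy pushouts -/

section descent

variable {W A B C D : Type u} [TopologicalSpace W] [TopologicalSpace A] [TopologicalSpace B]
  [TopologicalSpace C] [TopologicalSpace D]

/-- The part of the pullback that lies over `S` is itself the pullback of the restriction of `j`, so
continuity of `φ` can be tested there. -/
theorem HPullback.continuousOn_of_lift {X : Type u} [TopologicalSpace X] {Z : Type*}
    [TopologicalSpace Z] {j : C(X, C)} {q : C(D, C)} (S : Set X)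
    (F : C(HPullback (j.comp ⟨Subtype.val, continuous_subtype_val⟩ : C(S, C)) q, Z))
    {φ : HPullback j q → Z}
    (h : ∀ x, φ (mapLeft j q ⟨Subtype.val, continuous_subtype_val⟩ _ (fun _ => rfl) x) = F x) :
    ContinuousOn φ {y | fst j q y ∈ S} := by
  let l : C({y | fst j q y ∈ S},
      HPullback (j.comp ⟨Subtype.val, continuous_subtype_val⟩ : C(S, C)) q) :=
    lift ⟨fun y => ⟨fst j q y.1, y.2⟩, by fun_prop⟩ ⟨fun y => snd j q y.1, by fun_prop⟩
      ⟨fun p => path j q (p.1, p.2.1), by fun_prop⟩ (fun y => path_zero _) (fun y => path_one _)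
  rw [continuousOn_iff_continuous_domRestrict]
  refine (F.continuous.comp l.continuous).congr fun y => ?_
  refine (h (l y)).symm.trans (congrArg φ ?_)
  refine ext rfl rfl fun t ht => ?_
  rw [path_mapLeft _ ht]
  exact path_lift _ _ _ _ _ ht _

variable {f : C(W, A)} {g : C(W, B)} {α : C(A, C)} {β : C(B, C)} {γ : C(W, C)}
  (hα : ∀ w, α (f w) = γ w) (hβ : ∀ w, β (g w) = γ w) (q : C(D, C))

/-- The map out of a homotopy pushout given by a strictly commutative square. -/
def HPushout.descStrict : C(HPushout f g, C) :=
  descLine α β ⟨fun p => γ p.2, by fun_prop⟩ (fun w => (hα w).symm) (fun w => (hβ w).symm)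

@[simp] theorem HPushout.descStrict_inl (a : A) : descStrict hα hβ (inl f g a) = α a := rfl

@[simp] theorem HPushout.descStrict_inr (b : B) : descStrict hα hβ (inr f g b) = β b := rfl

theorem HPushout.descStrict_line (t : ℝ) (w : W) :
    descStrict hα hβ (line f g (t, w)) = γ w :=
  descLine_line_clamp _ _ _ _ _ t w

theorem HPushout.descStrict_stretch (s : I) (x : HPushout f g) :
    descStrict hα hβ (stretch f g (s, x)) = descStrict hα hβ x := by
  refine ind (p := fun x => descStrict hα hβ (stretch f g (s, x)) = descStrict hα hβ x)
    (fun _ => rfl) (fun _ => rfl) (fun t ht w => ?_) x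
  rw [stretch_line _ ht, descStrict_line, descStrict_line]

/-- The homotopy pushout of the pullbacks of the vertices of a span over a base. -/
abbrev PulledPushout : Type u :=
  HPushout (HPullback.mapLeft α q f γ hα) (HPullback.mapLeft β q g γ hβ)

/-- The cylinder part of `pulledComparison`. -/
noncomputable def pulledCylinder :
    C(ℝ × HPullback γ q, HPullback (HPushout.descStrict hα hβ) q) :=
  HPullback.lift ⟨fun p => HPushout.line f g (p.1, HPullback.fst γ q p.2), by fun_prop⟩
    ⟨fun p => HPullback.snd γ q p.2, by fun_prop⟩
    ⟨fun p => HPullback.path γ q (p.1, p.2.2), by fun_prop⟩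
    (by simp [HPushout.descStrict_line]) (by simp)

theorem path_pulledCylinder {t : ℝ} (ht : t ∈ I) (s : ℝ) (x : HPullback γ q) :
    HPullback.path _ q (t, pulledCylinder hα hβ q (s, x)) = HPullback.path _ q (t, x) :=
  HPullback.path_lift _ _ _ _ _ ht _

open HPullback in
/-- The comparison map from the homotopy pushout of pullbacks to the pullback of the homotopy
pushout. -/
noncomputable def pulledComparison :
    C(PulledPushout hα hβ q, HPullback (HPushout.descStrict hα hβ) q) :=
  HPushout.descLine (mapLeft _ q (HPushout.inl f g) α (HPushout.descStrict_inl hα hβ))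
    (mapLeft _ q (HPushout.inr f g) β (HPushout.descStrict_inr hα hβ)) (pulledCylinder hα hβ q)
    (by
      intro x
      refine HPullback.ext (HPushout.line_zero _) rfl fun t ht => ?_
      rw [path_mapLeft _ ht, path_mapLeft _ ht]
      exact path_lift _ _ _ _ _ ht _)
    (by
      intro x
      refine HPullback.ext (HPushout.line_one _) rfl fun t ht => ?_
      rw [path_mapLeft _ ht, path_mapLeft _ ht]
      exact path_lift _ _ _ _ _ ht _)

theorem pulledComparison_line (t : ℝ) (x : HPullback γ q) :
    pulledComparison hα hβ q (HPushout.line _ _ (t, x)) = pulledCylinder hα hβ q (t, x) := by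
  refine (HPushout.descLine_line_clamp _ _ _ _ _ t x).trans ?_
  refine HPullback.ext (HPushout.line_clamp t (HPullback.fst γ q x)) rfl fun s hs => ?_
  rw [path_pulledCylinder hα hβ q hs, path_pulledCylinder hα hβ q hs]

theorem path_pulledComparison_inl {t : ℝ} (ht : t ∈ I) (x : HPullback α q) :
    HPullback.path _ q (t, pulledComparison hα hβ q (HPushout.inl _ _ x)) =
      HPullback.path _ q (t, x) :=
  HPullback.path_mapLeft (HPushout.descStrict_inl hα hβ) ht x

theorem path_pulledComparison_inr {t : ℝ} (ht : t ∈ I) (x : HPullback β q) :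
    HPullback.path _ q (t, pulledComparison hα hβ q (HPushout.inr _ _ x)) =
      HPullback.path _ q (t, x) :=
  HPullback.path_mapLeft (HPushout.descStrict_inr hα hβ) ht x

theorem path_pulledComparison_line {t : ℝ} (ht : t ∈ I) (s : ℝ) (x : HPullback γ q) :
    HPullback.path _ q (t, pulledComparison hα hβ q (HPushout.line _ _ (s, x))) =
      HPullback.path _ q (t, x) := by
  rw [pulledComparison_line]
  exact HPullback.path_lift _ _ _ _ _ ht _

theorem fst_pulledComparison_line (t : ℝ) (x : HPullback γ q) :
    HPullback.fst _ q (pulledComparison hα hβ q (HPushout.line _ _ (t, x))) =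
      HPushout.line f g (t, HPullback.fst _ _ x) := by
  rw [pulledComparison_line]
  rfl

theorem snd_pulledComparison_line (t : ℝ) (x : HPullback γ q) :
    HPullback.snd _ q (pulledComparison hα hβ q (HPushout.line _ _ (t, x))) =
      HPullback.snd _ _ x := by
  rw [pulledComparison_line]
  rfl

/-- The first component determines the height and the point of the span; the path and the second
component are unchanged. Injectivity lets the inverse in the descent theorem be chosen pointwise and
then compared with continuous local formulas. -/
theorem pulledComparison_injective : Function.Injective (pulledComparison hα hβ q) := by
  let ht (y : PulledPushout hα hβ q) : ℝ :=
    HPushout.height f g (HPullback.fst _ q (pulledComparison hα hβ q y))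
  have hl (x : HPullback α q) : ht (HPushout.inl _ _ x) = 0 := rfl
  have hr (x : HPullback β q) : ht (HPushout.inr _ _ x) = 1 := rfl
  have hc {t : ℝ} (h : t ∈ Set.Ioo (0 : ℝ) 1) (x : HPullback γ q) :
      ht (HPushout.line _ _ (t, x)) = t := by
    simp only [ht]
    rw [fst_pulledComparison_line, HPushout.height_line (Set.Ioo_subset_Icc_self h)]
  intro y z h
  have h₁ : ht y = ht z := congrArg (fun y => HPushout.height f g (HPullback.fst _ q y)) h
  revert h h₁
  refine HPushout.ind_Ioo (p := fun y => pulledComparison hα hβ q y = pulledComparison hα hβ q z →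
    ht y = ht z → y = z) (fun a => ?_) (fun b => ?_) (fun t h₀ w => ?_) y
  · refine HPushout.ind_Ioo (p := fun z => pulledComparison hα hβ q (HPushout.inl _ _ a) =
      pulledComparison hα hβ q z → ht (HPushout.inl _ _ a) = ht z → HPushout.inl _ _ a = z)
      (fun a' h _ => ?_) (fun b' _ h => ?_) (fun t' h₀' w' _ h => ?_) z
    · refine congrArg _ (HPullback.ext
        (HPushout.inl_injective (congrArg (HPullback.fst _ q) h) :) (congrArg (HPullback.snd _ q) h :)
        fun t h₀ => ?_)
      rw [← path_pulledComparison_inl hα hβ q h₀, h, path_pulledComparison_inl hα hβ q h₀]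
    · rw [hl, hr] at h
      norm_num at h
    · rw [hl, hc h₀'] at h
      exact absurd h h₀'.1.ne
  · refine HPushout.ind_Ioo (p := fun z => pulledComparison hα hβ q (HPushout.inr _ _ b) =
      pulledComparison hα hβ q z → ht (HPushout.inr _ _ b) = ht z → HPushout.inr _ _ b = z)
      (fun a' _ h => ?_) (fun b' h _ => ?_) (fun t' h₀' w' _ h => ?_) z
    · rw [hl, hr] at h
      norm_num at h
    · refine congrArg _ (HPullback.ext
        (HPushout.inr_injective (congrArg (HPullback.fst _ q) h) :) (congrArg (HPullback.snd _ q) h :)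
        fun t h₀ => ?_)
      rw [← path_pulledComparison_inr hα hβ q h₀, h, path_pulledComparison_inr hα hβ q h₀]
    · rw [hr, hc h₀'] at h
      exact absurd h h₀'.2.ne'
  · refine HPushout.ind_Ioo (p := fun z => pulledComparison hα hβ q (HPushout.line _ _ (t, w)) =
      pulledComparison hα hβ q z → ht (HPushout.line _ _ (t, w)) = ht z →
        HPushout.line _ _ (t, w) = z)
      (fun a' _ h => ?_) (fun b' _ h => ?_) (fun t' h₀' w' h h₁ => ?_) z
    · rw [hl, hc h₀] at h
      exact absurd h h₀.1.ne'
    · rw [hr, hc h₀] at h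
      exact absurd h h₀.2.ne
    · rw [hc h₀, hc h₀'] at h₁
      subst h₁
      have hf := congrArg (HPullback.fst _ q) h
      have hs := congrArg (HPullback.snd _ q) h
      rw [fst_pulledComparison_line, fst_pulledComparison_line] at hf
      rw [snd_pulledComparison_line, snd_pulledComparison_line] at hs
      refine congrArg (fun w => HPushout.line _ _ (t, w))
        (HPullback.ext (HPushout.line_injective h₀.1 h₀.2 hf) hs fun s h' => ?_)
      rw [← path_pulledComparison_line hα hβ q h' t, h, path_pulledComparison_line hα hβ q h' t]

/-- The deformation of the pullback of a homotopy pushout that covers `HPushout.stretch`. -/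
noncomputable def pulledStretch :
    C(I × HPullback (HPushout.descStrict hα hβ) q, HPullback (HPushout.descStrict hα hβ) q) :=
  HPullback.lift
    ⟨fun p => HPushout.stretch f g (p.1, HPullback.fst _ q p.2),
      (HPushout.stretch f g).continuous.comp (by fun_prop)⟩
    ⟨fun p => HPullback.snd _ q p.2, by fun_prop⟩
    ⟨fun p => HPullback.path _ q (p.1, p.2.2), by fun_prop⟩
    (fun p => (HPullback.path_zero _).trans (HPushout.descStrict_stretch hα hβ _ _).symm)
    (fun p => HPullback.path_one _)

theorem path_pulledStretch (s : I) {t : ℝ} (ht : t ∈ I)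
    (x : HPullback (HPushout.descStrict hα hβ) q) :
    HPullback.path _ q (t, pulledStretch hα hβ q (s, x)) = HPullback.path _ q (t, x) :=
  HPullback.path_lift _ _ _ _ _ ht _

theorem pulledStretch_zero (x : HPullback (HPushout.descStrict hα hβ) q) :
    pulledStretch hα hβ q (0, x) = x :=
  HPullback.ext (HPushout.stretch_zero _) rfl fun _ ht => path_pulledStretch hα hβ q 0 ht x

/-- Stretching affects neither the path nor the second component. With injectivity, this identifies
the composite of the comparison and its inverse on the source with a stretch. -/
theorem pulledComparison_stretch (s : I) (y : PulledPushout hα hβ q) :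
    pulledComparison hα hβ q (HPushout.stretch _ _ (s, y)) =
      pulledStretch hα hβ q (s, pulledComparison hα hβ q y) := by
  refine HPushout.ind (p := fun y => pulledComparison hα hβ q (HPushout.stretch _ _ (s, y)) =
      pulledStretch hα hβ q (s, pulledComparison hα hβ q y)) (fun a => ?_) (fun b => ?_)
      (fun t ht w => ?_) y
  · exact HPullback.ext rfl rfl fun t ht => (path_pulledStretch hα hβ q s ht _).symm
  · exact HPullback.ext rfl rfl fun t ht => (path_pulledStretch hα hβ q s ht _).symm
  · rw [HPushout.stretch_line s ht, pulledComparison_line, pulledComparison_line]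
    exact HPullback.ext (HPushout.stretch_line s ht _).symm rfl fun t ht =>
      (path_pulledCylinder hα hβ q ht _ _).trans
        ((path_pulledStretch hα hβ q s ht _).trans (path_pulledCylinder hα hβ q ht _ _)).symm

/-- This lemma and the next two lift the time-1 stretch through the comparison, continuously over
each of the three ranges of height: the lift takes values in the left vertex, in the right vertex
and in the cylinder, respectively. -/
theorem pulledComparison_left {a : C({x : HPushout f g // HPushout.height f g x ≤ 1 / 3}, A)}
    (ha : ∀ x, HPushout.inl f g (a x) = HPushout.stretch f g (1, x)) : ∃ F : C(HPullback
      ((HPushout.descStrict hα hβ).comp ⟨Subtype.val, continuous_subtype_val⟩ :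
        C({x : HPushout f g // HPushout.height f g x ≤ 1 / 3}, C)) q, PulledPushout hα hβ q),
      ∀ x, pulledComparison hα hβ q (F x) = pulledStretch hα hβ q (1, HPullback.mapLeft _ q
        ⟨Subtype.val, continuous_subtype_val⟩ _ (fun _ => rfl) x) := by
  have h (x) : α (a x) = HPushout.descStrict hα hβ x.1 := by
    rw [← HPushout.descStrict_inl hα hβ, ha, HPushout.descStrict_stretch]
  refine ⟨(HPushout.inl _ _).comp (HPullback.mapLeft α q a _ h), fun x => ?_⟩
  refine HPullback.ext (ha _) rfl fun t ht => ?_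
  rw [path_pulledStretch hα hβ q 1 ht, HPullback.path_mapLeft _ ht]
  exact (path_pulledComparison_inl hα hβ q ht _).trans (HPullback.path_mapLeft _ ht _)

theorem pulledComparison_right {b : C({x : HPushout f g // 2 / 3 ≤ HPushout.height f g x}, B)}
    (hb : ∀ x, HPushout.inr f g (b x) = HPushout.stretch f g (1, x)) : ∃ F : C(HPullback
      ((HPushout.descStrict hα hβ).comp ⟨Subtype.val, continuous_subtype_val⟩ :
        C({x : HPushout f g // 2 / 3 ≤ HPushout.height f g x}, C)) q, PulledPushout hα hβ q),
      ∀ x, pulledComparison hα hβ q (F x) = pulledStretch hα hβ q (1, HPullback.mapLeft _ q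
        ⟨Subtype.val, continuous_subtype_val⟩ _ (fun _ => rfl) x) := by
  have h (x) : β (b x) = HPushout.descStrict hα hβ x.1 := by
    rw [← HPushout.descStrict_inr hα hβ, hb, HPushout.descStrict_stretch]
  refine ⟨(HPushout.inr _ _).comp (HPullback.mapLeft β q b _ h), fun x => ?_⟩
  refine HPullback.ext (hb _) rfl fun t ht => ?_
  rw [path_pulledStretch hα hβ q 1 ht, HPullback.path_mapLeft _ ht]
  exact (path_pulledComparison_inr hα hβ q ht _).trans (HPullback.path_mapLeft _ ht _)

theorem pulledComparison_middle
    {c : C({x : HPushout f g // HPushout.height f g x ∈ Set.Icc (1 / 3 : ℝ) (2 / 3)}, W)}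
    (hc : ∀ x, HPushout.line f g (HPushout.height f g x.1, c x) = x.1) : ∃ F : C(HPullback
      ((HPushout.descStrict hα hβ).comp ⟨Subtype.val, continuous_subtype_val⟩ :
        C({x : HPushout f g // HPushout.height f g x ∈ Set.Icc (1 / 3 : ℝ) (2 / 3)}, C)) q,
        PulledPushout hα hβ q),
      ∀ x, pulledComparison hα hβ q (F x) = pulledStretch hα hβ q (1, HPullback.mapLeft _ q
        ⟨Subtype.val, continuous_subtype_val⟩ _ (fun _ => rfl) x) := by
  have h (x) : γ (c x) = HPushout.descStrict hα hβ x.1 := by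
    rw [← HPushout.descStrict_line hα hβ (HPushout.height f g x.1), hc]
  refine ⟨⟨fun x => HPushout.line _ _ (3 * HPushout.height f g (HPullback.fst _ q x).1 - 1,
    HPullback.mapLeft γ q c _ h x), by fun_prop⟩, fun x => ?_⟩
  refine HPullback.ext ?_ (snd_pulledComparison_line hα hβ q _ _) fun t ht => ?_
  · refine (fst_pulledComparison_line hα hβ q _ _).trans ?_
    have := hc (HPullback.fst _ q x)
    change HPushout.line f g (_, c (HPullback.fst _ q x)) =
      HPushout.stretch f g (1, (HPullback.fst _ q x).1)
    have hI : HPushout.height f g (HPullback.fst _ q x).1 ∈ I :=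
      ⟨by linarith [(HPullback.fst _ q x).2.1], by linarith [(HPullback.fst _ q x).2.2]⟩
    conv_rhs => rw [← this]
    rw [HPushout.stretch_one_line hI]
  · rw [path_pulledStretch hα hβ q 1 ht, HPullback.path_mapLeft _ ht]
    exact (path_pulledComparison_line hα hβ q ht _ _).trans (HPullback.path_mapLeft _ ht _)

/-- Pullbacks commute with homotopy pushouts of strictly commutative squares. -/
theorem isHEquiv_pulledComparison : IsHEquiv (pulledComparison hα hβ q) := by
  obtain ⟨a, ha⟩ := HPushout.exists_retract_left (f := f) (g := g)
  obtain ⟨b, hb⟩ := HPushout.exists_retract_right (f := f) (g := g)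
  obtain ⟨c, hc⟩ := HPushout.exists_middle (f := f) (g := g)
  obtain ⟨F₁, h₁⟩ := pulledComparison_left hα hβ q ha
  obtain ⟨F₂, h₂⟩ := pulledComparison_right hα hβ q hb
  obtain ⟨F₃, h₃⟩ := pulledComparison_middle hα hβ q hc
  let H (y : HPullback (HPushout.descStrict hα hβ) q) : ℝ :=
    HPushout.height f g (HPullback.fst _ q y)
  have hH : Continuous H := by fun_prop
  have inj := pulledComparison_injective hα hβ q
  have cover (y : HPullback (HPushout.descStrict hα hβ) q) (S : Set (HPushout f g))
      (hy : HPullback.fst _ q y ∈ S) : ∃ x : HPullback ((HPushout.descStrict hα hβ).comp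
        ⟨Subtype.val, continuous_subtype_val⟩ : C(S, C)) q, HPullback.mapLeft _ q
        ⟨Subtype.val, continuous_subtype_val⟩ _ (fun _ => rfl) x = y :=
    ⟨⟨(⟨y.1.1, hy⟩, y.1.2), y.2⟩, HPullback.ext rfl rfl fun t ht =>
      HPullback.path_mapLeft (fun _ => rfl) ht _⟩
  have hex (y : HPullback (HPushout.descStrict hα hβ) q) :
      ∃ z, pulledComparison hα hβ q z = pulledStretch hα hβ q (1, y) := by
    rcases le_total (H y) (1 / 3) with h | h
    · obtain ⟨x, rfl⟩ := cover y {x | HPushout.height f g x ≤ 1 / 3} h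
      exact ⟨_, h₁ x⟩
    · rcases le_total (2 / 3) (H y) with h' | h'
      · obtain ⟨x, rfl⟩ := cover y {x | 2 / 3 ≤ HPushout.height f g x} h'
        exact ⟨_, h₂ x⟩
      · obtain ⟨x, rfl⟩ := cover y {x | HPushout.height f g x ∈ Set.Icc (1 / 3 : ℝ) (2 / 3)} ⟨h, h'⟩
        exact ⟨_, h₃ x⟩
  -- The inverse sends a point to the preimage of its stretch. By injectivity it agrees with the
  -- three lifts, so it is continuous on three closed sets that cover the space.
  choose φ hφ using hex
  have c₁ : ContinuousOn φ {y | H y ≤ 1 / 3} :=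
    HPullback.continuousOn_of_lift {x | HPushout.height f g x ≤ 1 / 3} F₁
      fun x => inj ((hφ _).trans (h₁ x).symm)
  have c₂ : ContinuousOn φ {y | 2 / 3 ≤ H y} :=
    HPullback.continuousOn_of_lift {x | 2 / 3 ≤ HPushout.height f g x} F₂
      fun x => inj ((hφ _).trans (h₂ x).symm)
  have c₃ : ContinuousOn φ {y | H y ∈ Set.Icc (1 / 3 : ℝ) (2 / 3)} :=
    HPullback.continuousOn_of_lift {x | HPushout.height f g x ∈ Set.Icc (1 / 3 : ℝ) (2 / 3)} F₃
      fun x => inj ((hφ _).trans (h₃ x).symm)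
  have k₁ : IsClosed {y | H y ≤ 1 / 3} := isClosed_le hH continuous_const
  have k₂ : IsClosed {y | 2 / 3 ≤ H y} := isClosed_le continuous_const hH
  have k₃ : IsClosed {y | H y ∈ Set.Icc (1 / 3 : ℝ) (2 / 3)} := isClosed_Icc.preimage hH
  have hcont : Continuous φ := by
    rw [← continuousOn_univ]
    refine ((c₁.union_of_isClosed c₃ k₁ k₃).union_of_isClosed c₂ (k₁.union k₃) k₂).mono ?_
    intro y _
    rcases le_total (H y) (1 / 3) with h | h
    · exact .inl (.inl h)
    · rcases le_total (2 / 3) (H y) with h' | h'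
      · exact .inr h'
      · exact .inl (.inr ⟨h, h'⟩)
  -- Both composites are time-1 stretches, and the stretches themselves are the homotopies from the
  -- identity.
  refine ⟨⟨φ, hcont⟩, ?_, ?_⟩
  · refine Homotopic.symm ⟨{ toContinuousMap := HPushout.stretch _ _, map_zero_left := ?_,
                             map_one_left := ?_ }⟩
    · exact HPushout.stretch_zero
    · exact fun y => inj ((pulledComparison_stretch hα hβ q 1 y).trans (hφ _).symm)
  · refine Homotopic.symm ⟨{ toContinuousMap := pulledStretch hα hβ q, map_zero_left := ?_,
                             map_one_left := ?_ }⟩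
    · exact pulledStretch_zero hα hβ q
    · exact fun y => (hφ y).symm

end descent

/-! ### The homotopy fibre of the join with a base point -/

section fiberJoin

open HPullback

variable {E B : Type u} [TopologicalSpace E] [TopologicalSpace B] (p : C(E, B)) (b : B)

/-- The map from the point that picks `b`. -/
abbrev basePoint : C(PUnit.{u + 1}, B) := ContinuousMap.const PUnit.{u + 1} b

/-- The homotopy fiber of a map. -/
abbrev Fiber : Type u := HPullback p (basePoint b)

/-- The space of based loops, as the homotopy fiber of the base point. -/
abbrev LoopSpace : Type u := HPullback (basePoint b) (basePoint b)

/-- A path to the base point, followed by the reverse of a loop, with parameters in `[-1, 1]`. -/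
noncomputable def fiberStrip : C(ℝ × Fiber p b × LoopSpace b, B) :=
  glueZero ⟨fun q => path p (basePoint b) (1 + q.1, q.2.1), by fun_prop⟩
    ⟨fun q => path (basePoint b) (basePoint b) (1 - q.1, q.2.2), by fun_prop⟩ (by simp)

variable {p b}

theorem fiberStrip_of_nonpos {t : ℝ} (ht : t ≤ 0) (x : Fiber p b × LoopSpace b) :
    fiberStrip p b (t, x) = path p (basePoint b) (1 + t, x.1) :=
  glueZero_of_nonpos ht

theorem fiberStrip_of_nonneg {t : ℝ} (ht : 0 ≤ t) (x : Fiber p b × LoopSpace b) :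
    fiberStrip p b (t, x) = path (basePoint b) (basePoint b) (1 - t, x.2) :=
  glueZero_of_nonneg ht

@[simp] theorem fiberStrip_neg_one (x : Fiber p b × LoopSpace b) :
    fiberStrip p b (-1, x) = p (fst _ _ x.1) := by
  simp [fiberStrip_of_nonpos]

@[simp] theorem fiberStrip_zero (x : Fiber p b × LoopSpace b) : fiberStrip p b (0, x) = b := by
  simp [fiberStrip_of_nonpos]

@[simp] theorem fiberStrip_one (x : Fiber p b × LoopSpace b) : fiberStrip p b (1, x) = b := by
  simp [fiberStrip_of_nonneg]

variable (p b)

/-- The right action of the inverses of loops on the homotopy fiber. -/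
noncomputable def fiberAct : C(Fiber p b × LoopSpace b, Fiber p b) :=
  lift ⟨fun x => fst _ _ x.1, by fun_prop⟩ ⟨fun x => snd _ _ x.1, by fun_prop⟩
    ⟨fun q => fiberStrip p b (2 * q.1 - 1, q.2), by fun_prop⟩ (by simp) (by intro x; norm_num)

/-- The reversal of loops. -/
noncomputable def loopReverse : C(LoopSpace b, LoopSpace b) :=
  lift (fst _ _) (snd _ _) ⟨fun q => path _ _ (1 - q.1, q.2), by fun_prop⟩ (by simp) (by simp)

variable {p b}

theorem path_fiberAct {t : ℝ} (ht : t ∈ I) (x : Fiber p b × LoopSpace b) :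
    path _ _ (t, fiberAct p b x) = fiberStrip p b (2 * t - 1, x) :=
  path_lift _ _ _ _ _ ht _

theorem path_loopReverse {t : ℝ} (ht : t ∈ I) (x : LoopSpace b) :
    path _ _ (t, loopReverse b x) = path _ _ (1 - t, x) :=
  path_lift _ _ _ _ _ ht _

theorem loopReverse_loopReverse (x : LoopSpace b) : loopReverse b (loopReverse b x) = x := by
  refine HPullback.ext rfl rfl fun t ht => ?_
  rw [path_loopReverse ht, path_loopReverse ⟨by linarith [ht.2], by linarith [ht.1]⟩]
  simp

variable (p b)

theorem isHEquiv_loopReverse : IsHEquiv (loopReverse b) :=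
  isHEquiv_of_inverse _ _ loopReverse_loopReverse loopReverse_loopReverse

/-- The map (x, ℓ) ↦ (x ℓ⁻¹, ℓ⁻¹) is its own inverse up to homotopy, because (x ℓ⁻¹) ℓ contracts to
x. -/
theorem isHEquiv_fiberAct_reverse :
    IsHEquiv ((fiberAct p b).prodMk ((loopReverse b).comp ContinuousMap.snd)) := by
  set ρ := (fiberAct p b).prodMk ((loopReverse b).comp ContinuousMap.snd) with hρ
  have h₁ : ((fiberAct p b).comp ρ).Homotopic ContinuousMap.fst := by
    -- The parameter `min (4 t - 1) (2 - 2 t)` goes from -1 to 1 and back to 0, that is, along x,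
    -- ℓ⁻¹ and ℓ; the parameter `t - 1` goes along x only.
    refine homotopic_of ⟨fun q => fst _ _ q.2.1, by fun_prop⟩ ⟨fun q => snd _ _ q.2.1, by fun_prop⟩
      ⟨fun q => fiberStrip p b ((1 - q.1) * min (4 * q.2.1 - 1) (2 - 2 * q.2.1) +
        q.1 * (q.2.1 - 1), q.2.2), by fun_prop⟩ ?_ ?_ (fun _ => rfl) (fun _ => rfl) (fun _ => rfl)
        (fun _ => rfl) ?_ ?_
    · intro s hs x
      have : (1 - s) * min (4 * 0 - 1) (2 - 2 * 0) + s * (0 - 1) = -1 := by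
        norm_num
        ring
      simp only [coe_mk, this, fiberStrip_neg_one]
    · intro s hs x
      norm_num
    · intro t ht x
      rw [ContinuousMap.comp_apply, path_fiberAct ht]
      obtain ⟨ht0, ht1⟩ := ht
      simp only [coe_mk, sub_zero, one_mul, zero_mul, add_zero]
      rcases le_total t (1 / 2) with h | h
      · rw [min_eq_left (by linarith), fiberStrip_of_nonpos (t := 2 * t - 1) (by linarith)]
        refine Eq.trans ?_ (path_fiberAct ⟨by linarith, by linarith⟩ x).symm
        ring_nf
      · rw [min_eq_right (by linarith), fiberStrip_of_nonneg (by linarith),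
          fiberStrip_of_nonneg (t := 2 * t - 1) (by linarith)]
        refine Eq.trans ?_ (path_loopReverse ⟨by linarith, by linarith⟩ x.2).symm
        ring_nf
    · intro t ht x
      simp only [coe_mk, sub_self, one_mul, zero_mul, zero_add]
      rw [fiberStrip_of_nonpos (by linarith [ht.2])]
      simp
  have h₂ : (ρ.comp ρ).Homotopic (.id _) := by
    have : ρ.comp ρ = ((fiberAct p b).comp ρ).prodMk ContinuousMap.snd :=
      ContinuousMap.ext fun x => Prod.ext rfl (loopReverse_loopReverse _)
    rw [this]
    exact h₁.prodMk (.refl _)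
  exact ⟨ρ, h₂, h₂⟩

/-- The shearing map from the product of the fiber and the loop space to the pullback of the path
fibration along the constant map of the fiber. -/
noncomputable def shear :
    C(Fiber p b × LoopSpace b, HPullback (ContinuousMap.const (Fiber p b) b) (basePoint b)) :=
  lift (fiberAct p b) ⟨fun x => snd _ _ x.2, by fun_prop⟩
    ⟨fun q => path _ _ (q.1, q.2.2), by fun_prop⟩ (by simp) (by simp)

variable {p b} in
theorem path_shear {t : ℝ} (ht : t ∈ I) (x : Fiber p b × LoopSpace b) :
    path _ _ (t, shear p b x) = path _ _ (t, x.2) :=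
  path_lift _ _ _ _ _ ht _

/-- The target is a product of the fibre and the loop space by `k`. There the shear reads (x, ℓ) ↦
(x ℓ⁻¹, ℓ), which is the previous involution followed by reversal of the loop. -/
theorem isHEquiv_shear : IsHEquiv (shear p b) := by
  let k : C(HPullback (ContinuousMap.const (Fiber p b) b) (basePoint b),
      Fiber p b × LoopSpace b) :=
    (fst _ _).prodMk (lift (.const _ PUnit.unit) (snd _ _) (path _ _) (by simp) (by simp))
  let k' : C(Fiber p b × LoopSpace b,
      HPullback (ContinuousMap.const (Fiber p b) b) (basePoint b)) :=
    lift ContinuousMap.fst ⟨fun x => snd _ _ x.2, by fun_prop⟩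
      ⟨fun q => path _ _ (q.1, q.2.2), by fun_prop⟩ (by simp) (by simp)
  have hk : IsHEquiv k := isHEquiv_of_inverse k k'
    (fun x => HPullback.ext rfl rfl fun t ht => by
      refine (path_lift _ _ _ _ _ ht _ : path _ _ (t, k' (k x)) = _).trans ?_
      change path _ _ (t, (k x).2) = _
      exact path_lift _ _ _ _ _ ht _)
    (fun x => Prod.ext rfl (HPullback.ext rfl rfl fun t ht =>
      (path_lift _ _ _ _ _ ht _).trans (path_lift _ _ _ _ _ ht _)))
  refine hk.of_comp_left ?_
  have : k.comp (shear p b) = ((ContinuousMap.id _).prodMap (loopReverse b)).comp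
      ((fiberAct p b).prodMk ((loopReverse b).comp ContinuousMap.snd)) := by
    refine ContinuousMap.ext fun x => Prod.ext rfl ?_
    refine Eq.trans ?_ (loopReverse_loopReverse x.2).symm
    exact HPullback.ext rfl rfl fun t ht =>
      (path_lift _ _ _ _ _ ht _).trans (path_lift _ _ _ _ _ ht _)
  rw [this]
  exact (isHEquiv_id.prodMap (isHEquiv_loopReverse b)).comp (isHEquiv_fiberAct_reverse p b)

/-- The mapping path space of a map. -/
abbrev PathSpace : Type u := HPullback p (.id B)

/-- The inclusion of the domain in the mapping path space. -/
noncomputable def constPath : C(E, PathSpace p) :=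
  lift (.id E) p ⟨fun q => p q.2, by fun_prop⟩ (fun _ => rfl) (fun _ => rfl)

theorem path_constPath {t : ℝ} (ht : t ∈ I) (e : E) : path _ _ (t, constPath p e) = p e :=
  path_lift _ _ _ _ _ ht _

/-- Truncation of the paths in the homotopy fiber. -/
noncomputable def truncate : C(ℝ × Fiber p b, PathSpace p) :=
  lift ⟨fun q => fst _ _ q.2, by fun_prop⟩ (path _ _)
    ⟨fun q => path _ _ (q.1 * q.2.1, q.2.2), by fun_prop⟩ (by simp) (by simp)

/-- The inclusion of the homotopy fiber in the mapping path space. -/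
noncomputable def fiberIncl : C(Fiber p b, PathSpace p) :=
  ⟨fun x => truncate p b (1, x), by fun_prop⟩

variable {p b}

theorem path_truncate {t : ℝ} (ht : t ∈ I) (s : ℝ) (x : Fiber p b) :
    path _ _ (t, truncate p b (s, x)) = path _ _ (t * s, x) :=
  path_lift _ _ _ _ _ ht _

theorem truncate_zero (x : Fiber p b) : truncate p b (0, x) = constPath p (fst _ _ x) :=
  HPullback.ext rfl (path_zero _) fun t ht => by
    rw [path_truncate ht, path_constPath p ht]
    simp

theorem snd_fiberIncl (x : Fiber p b) : snd _ _ (fiberIncl p b x) = b := path_one x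

theorem path_fiberIncl {t : ℝ} (ht : t ∈ I) (x : Fiber p b) :
    path _ _ (t, fiberIncl p b x) = path _ _ (t, x) :=
  (path_truncate ht 1 x).trans (by simp)

variable (p b)

theorem isHEquiv_constPath : IsHEquiv (constPath p) := by
  refine ⟨fst _ _, .refl _, ?_⟩
  refine homotopic_of ⟨fun q => fst _ _ q.2, by fun_prop⟩ (path _ _)
    ⟨fun q => path _ _ (q.1 * q.2.1, q.2.2), by fun_prop⟩ ?_ ?_ (fun _ => rfl) (fun _ => rfl)
    ?_ ?_ ?_ ?_
  · intro s hs x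
    simp
  · intro s hs x
    simp
  · intro x
    exact path_zero x
  · intro x
    exact path_one x
  · intro t ht x
    rw [ContinuousMap.comp_apply, path_constPath p ht]
    simp
  · intro t ht x
    simp

variable {p b} in
theorem basePoint_snd (x : Fiber p b) :
    basePoint b (snd p (basePoint b) x) = ContinuousMap.const (Fiber p b) b x := rfl

/-- The join with the base point, for a strict model of the join. -/
noncomputable def strictJoinMap : C(HPushout (fiberIncl p b) (snd p (basePoint b)), B) :=
  HPushout.descStrict (α := snd p (.id B)) (β := basePoint b)
    (γ := ContinuousMap.const (Fiber p b) b) snd_fiberIncl basePoint_snd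

/-- Descent is available for strictly commutative squares. Hence `E` is replaced by the mapping path
space with evaluation at the end, and the leg from the fibre by `fiberIncl`, whose values end at
`b`. Truncation of paths is the homotopy between the old leg and the new one. -/
theorem exists_fiber_joinMap_strict : ∃ Θ : C(HPullback (joinMap p (basePoint b)) (basePoint b),
    HPullback (strictJoinMap p b) (basePoint b)), IsHEquiv Θ := by
  have h₀ (x : Fiber p b) : truncate p b (0, x) = ((constPath p).comp (fst _ _)) x :=
    truncate_zero x
  have h₁ (x : Fiber p b) : truncate p b (1, x) = fiberIncl p b x := rfl
  let M := HPushout.moveLeft ((constPath p).comp (fst _ _)) (fiberIncl p b)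
    (snd p (basePoint b)) (truncate p b) h₀ h₁
  let N := HPushout.mapLeft (fst p (basePoint b)) (snd p (basePoint b)) (constPath p)
    ((constPath p).comp (fst _ _)) fun _ => rfl
  refine exists_map (f := strictJoinMap p b) (α := M.comp N)
    ((HPushout.isHEquiv_moveLeft _ _).comp (HPushout.isHEquiv_mapLeft (isHEquiv_constPath p) _))
    ?_ (basePoint b)
  -- On the cylinder the strict model follows the path at double speed and then rests at `b`, which
  -- is the clamped path at `2 t`. The two speeds are interpolated linearly.
  refine Homotopic.symm (HPushout.homotopic_of ⟨fun q => p q.2, by fun_prop⟩ (.const _ b)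
    ⟨fun q => path _ _ ((1 - q.1) * (2 * q.2.1) + q.1 * q.2.1, q.2.2), by fun_prop⟩
    ?_ ?_ (fun _ => rfl) (fun _ => rfl) (fun _ => rfl) (fun _ => rfl) ?_ ?_)
  · intro s hs x
    simp
  · intro s hs x
    exact path_of_one_le (by linarith [hs.2]) x
  · intro t ht x
    have hN : N (HPushout.line _ _ (t, x)) = HPushout.line _ _ (t, x) :=
      HPushout.mapLeft_line _ ht x
    have hM : M (HPushout.line _ _ (t, x)) = HPushout.moveStrip _ _ _ _ (2 * t - 1, x) :=
      HPushout.moveLeft_line _ _ ht x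
    rw [ContinuousMap.comp_apply, ContinuousMap.comp_apply, hN, hM]
    rcases le_total (2 * t - 1) 0 with h | h
    · rw [HPushout.moveStrip_of_nonpos h]
      change _ = path _ _ (1 + (2 * t - 1), x)
      simp
    · rw [HPushout.moveStrip_of_nonneg h]
      refine Eq.trans ?_ (HPushout.descStrict_line snd_fiberIncl basePoint_snd _ x).symm
      exact path_of_one_le (by simp; linarith) x
  · intro t ht x
    have : joinMap p (basePoint b) (HPushout.line _ _ (t, x)) = path _ _ (t, x) := by
      lift t to I using ht
      rw [HPushout.line_coe, path_coe]
      rfl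
    rw [this]
    simp

/-- After the shear, the left leg is x ℓ⁻¹ followed by ℓ, which is homotopic to x, and the right leg
is ℓ. The span is thus equivalent to the pair of projections. -/
theorem exists_join_pulledPushout : ∃ Θ : C(Join (Fiber p b) (LoopSpace b),
    PulledPushout (g := snd p (basePoint b)) (α := snd p (.id B)) (β := basePoint b)
      (γ := ContinuousMap.const (Fiber p b) b) snd_fiberIncl basePoint_snd (basePoint b)),
    IsHEquiv Θ := by
  let f' := mapLeft (snd p (.id B)) (basePoint b) (fiberIncl p b)
    (ContinuousMap.const (Fiber p b) b) snd_fiberIncl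
  let g' := mapLeft (basePoint b) (basePoint b) (snd p (basePoint b))
    (ContinuousMap.const (Fiber p b) b) basePoint_snd
  let α := mapLeft (snd p (.id B)) (basePoint b) (constPath p) p fun _ => rfl
  have hf : (α.comp ContinuousMap.fst).Homotopic (f'.comp (shear p b)) := by
    let Ha : C(ℝ × Fiber p b × LoopSpace b, PathSpace p) :=
      lift ⟨fun q => fst _ _ q.2.1, by fun_prop⟩
        ⟨fun q => fiberStrip p b (2 * q.1 - 1, q.2), by fun_prop⟩
        ⟨fun q => fiberStrip p b (2 * q.2.1 * q.1 - 1, q.2.2), by fun_prop⟩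
        (by simp) (by simp)
    -- A point of the target consists of two consecutive paths. The homotopy moves their common
    -- point along the strip, from parameter -1 to 1; at time `s` the second path runs from `2 s -
    -- 1` to 0.
    refine homotopic_of Ha (.const _ PUnit.unit)
      ⟨fun q => fiberStrip p b ((1 - q.2.1) * (2 * q.1 - 1), q.2.2), by fun_prop⟩ ?_ ?_ ?_ ?_
      (fun _ => rfl) (fun _ => rfl) ?_ ?_
    · intro s hs x
      change fiberStrip p b ((1 - 0) * (2 * s - 1), x) = fiberStrip p b (2 * s - 1, x)
      simp
    · intro s hs x
      simp
    · intro x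
      refine HPullback.ext rfl ?_ fun t ht => ?_
      · change fiberStrip p b (2 * 0 - 1, x) = p (fst _ _ x.1)
        simp
      · refine (path_lift _ _ _ _ _ ht _).trans (Eq.trans ?_ (path_constPath p ht _).symm)
        simp
    · intro x
      refine HPullback.ext rfl ?_ fun t ht => ?_
      · refine Eq.trans ?_ (snd_fiberIncl _).symm
        change fiberStrip p b (2 * 1 - 1, x) = b
        norm_num
      · refine (path_lift _ _ _ _ _ ht _).trans (Eq.trans ?_ (path_fiberIncl ht _).symm)
        refine Eq.trans ?_ (path_fiberAct ht x).symm
        simp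
    · intro t ht x
      refine Eq.trans ?_ (path_mapLeft (f := snd p (.id B)) (fun _ => rfl) ht x.1).symm
      simp only [coe_mk]
      rw [fiberStrip_of_nonpos (by linarith [ht.2])]
      simp
    · intro t ht x
      refine Eq.trans ?_ ((path_mapLeft snd_fiberIncl ht _).trans (path_shear ht x)).symm
      simp only [coe_mk]
      rw [fiberStrip_of_nonneg (by linarith [ht.2])]
      norm_num
  have hg : (ContinuousMap.id (LoopSpace b)).comp ContinuousMap.snd = g'.comp (shear p b) := by
    refine ContinuousMap.ext fun x => HPullback.ext rfl rfl fun t ht => ?_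
    exact ((path_mapLeft basePoint_snd ht _).trans (path_shear ht x)).symm
  have hα : IsHEquiv α := isHEquiv_mapLeft (isHEquiv_constPath p) fun _ => rfl
  have hg' : ((ContinuousMap.id (LoopSpace b)).comp ContinuousMap.snd).Homotopic
      (g'.comp (shear p b)) := by rw [hg]
  obtain ⟨Θ, h, -⟩ := HPushout.exists_map hα isHEquiv_id (isHEquiv_shear p b) hf hg'
  exact ⟨Θ, h⟩

/-- The homotopy fiber of the join of a map with the base point is the join of the homotopy
fibers. -/
theorem exists_join_fiber : ∃ Θ : C(Join (Fiber p b) (LoopSpace b),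
    Fiber (joinMap p (basePoint b)) b), IsHEquiv Θ := by
  obtain ⟨Θ₁, h₁⟩ := exists_fiber_joinMap_strict p b
  obtain ⟨Θ₂, h₂⟩ := exists_join_pulledPushout p b
  obtain ⟨e, -⟩ := h₁.exists_equiv
  exact ⟨_, (isHEquiv_toFun e.symm).comp
    ((isHEquiv_pulledComparison snd_fiberIncl basePoint_snd (basePoint b)).comp h₂)⟩

end fiberJoin

/-! ### Products and sums of homotopy pushouts -/

namespace HPushout

section constructions

variable {W A B D : Type*} [TopologicalSpace W] [TopologicalSpace A] [TopologicalSpace B]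
  [TopologicalSpace D]

/-- A homotopy pushout maps to a point by a homotopy equivalence if its left leg is one and its
right vertex is a point. -/
theorem isHEquiv_const {f : C(W, A)} {g : C(W, PUnit.{u + 1})} (hf : IsHEquiv f) :
    IsHEquiv (ContinuousMap.const (HPushout f g) PUnit.unit.{v + 1}) := by
  refine (isHEquiv_inr (g := g) hf).of_comp_right ?_
  exact isHEquiv_of_inverse _ (.const _ PUnit.unit) (fun _ => rfl) fun _ => rfl

/-- The comparison of the homotopy pushout of products with the product of a homotopy pushout. -/
noncomputable def prodComparison (D : Type*) [TopologicalSpace D] (f : C(W, A)) (g : C(W, B)) :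
    C(HPushout ((ContinuousMap.id D).prodMap f) ((ContinuousMap.id D).prodMap g),
      D × HPushout f g) :=
  descLine ((ContinuousMap.id D).prodMap (inl f g)) ((ContinuousMap.id D).prodMap (inr f g))
    ⟨fun q => (q.2.1, line f g (q.1, q.2.2)), by fun_prop⟩
    (fun q => Prod.ext rfl (line_zero _)) (fun q => Prod.ext rfl (line_one _))

/-- The comparison is bijective; local compactness of `D` enters through `descFamily`, which makes
the inverse continuous. -/
theorem isHEquiv_prodComparison [LocallyCompactSpace D] (f : C(W, A)) (g : C(W, B)) :
    IsHEquiv (prodComparison D f g) := by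
  let i : C(D × HPushout f g,
      HPushout ((ContinuousMap.id D).prodMap f) ((ContinuousMap.id D).prodMap g)) :=
    descFamily (inl _ _) (inr _ _) ⟨fun q => line _ _ (q.2.1, q.1, q.2.2), by fun_prop⟩
      (fun s w => line_zero _) (fun s w => line_one _)
  have h₁ {t : ℝ} (ht : t ∈ I) (w : D × W) :
      prodComparison D f g (line _ _ (t, w)) = (w.1, line f g (t, w.2)) :=
    descLine_line _ _ _ _ _ ht w
  have h₂ {t : ℝ} (ht : t ∈ I) (d : D) (w : W) :
      i (d, line _ _ (t, w)) = line _ _ (t, d, w) :=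
    descFamily_line _ _ _ _ _ d ht w
  refine isHEquiv_of_inverse _ i ?_ ?_
  · refine ind (fun a => rfl) (fun b => rfl) fun t ht w => ?_
    rw [h₁ ht, h₂ ht]
  · rintro ⟨d, x⟩
    refine ind (p := fun x => prodComparison D f g (i (d, x)) = (d, x)) (fun a => rfl)
      (fun b => rfl) (fun t ht w => ?_) x
    rw [h₂ ht, h₁ ht]

section split

variable {W₁ W₂ B₁ B₂ : Type*} [TopologicalSpace W₁] [TopologicalSpace W₂] [TopologicalSpace B₁]
  [TopologicalSpace B₂]

/-- The copairing of two continuous maps. -/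
def sumElim (f₁ : C(W₁, A)) (f₂ : C(W₂, A)) : C(W₁ ⊕ W₂, A) := ⟨Sum.elim f₁ f₂, by fun_prop⟩

/-- The sum of two continuous maps. -/
def sumMap (g₁ : C(W₁, B₁)) (g₂ : C(W₂, B₂)) : C(W₁ ⊕ W₂, B₁ ⊕ B₂) := ⟨Sum.map g₁ g₂, by fun_prop⟩

/-- A homotopy pushout along a sum of maps can be formed in two steps. -/
theorem exists_split (f₁ : C(W₁, A)) (f₂ : C(W₂, A)) (g₁ : C(W₁, B₁)) (g₂ : C(W₂, B₂)) :
    ∃ Θ : C(HPushout (sumElim f₁ f₂) (sumMap g₁ g₂), HPushout ((inl f₁ g₁).comp f₂) g₂),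
      IsHEquiv Θ := by
  let F : C(HPushout (sumElim f₁ f₂) (sumMap g₁ g₂), HPushout ((inl f₁ g₁).comp f₂) g₂) :=
    descLine ((inl _ _).comp (inl _ _)) (sumElim ((inl _ _).comp (inr _ _)) (inr _ _))
      ⟨fun q => Sum.elim (fun w => inl _ _ (line f₁ g₁ (q.1, w)))
        (fun w => line ((inl f₁ g₁).comp f₂) g₂ (q.1, w)) q.2,
        continuous_prod_sum ((inl ((inl f₁ g₁).comp f₂) g₂).comp (line f₁ g₁)).continuous
          (line ((inl f₁ g₁).comp f₂) g₂).continuous⟩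
      (by
        rintro (w | w)
        · exact congrArg (inl ((inl f₁ g₁).comp f₂) g₂) (line_zero (f := f₁) (g := g₁) w)
        · exact line_zero w)
      (by
        rintro (w | w)
        · exact congrArg (inl ((inl f₁ g₁).comp f₂) g₂) (line_one (f := f₁) (g := g₁) w)
        · exact line_one w)
  let G₁ : C(HPushout f₁ g₁, HPushout (sumElim f₁ f₂) (sumMap g₁ g₂)) :=
    descLine (inl _ _) ⟨fun b => inr _ _ (.inl b), by fun_prop⟩
      ⟨fun q => line _ _ (q.1, .inl q.2), by fun_prop⟩ (fun w => line_zero _) (fun w => line_one _)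
  let G : C(HPushout ((inl f₁ g₁).comp f₂) g₂, HPushout (sumElim f₁ f₂) (sumMap g₁ g₂)) :=
    descLine G₁ ⟨fun b => inr _ _ (.inr b), by fun_prop⟩
      ⟨fun q => line _ _ (q.1, .inr q.2), by fun_prop⟩ (fun w => line_zero _) (fun w => line_one _)
  have hF₁ {t : ℝ} (ht : t ∈ I) (w : W₁) :
      F (line _ _ (t, .inl w)) = inl _ _ (line f₁ g₁ (t, w)) := descLine_line _ _ _ _ _ ht _
  have hF₂ {t : ℝ} (ht : t ∈ I) (w : W₂) :
      F (line _ _ (t, .inr w)) = line _ _ (t, w) := descLine_line _ _ _ _ _ ht _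
  have hG₁ {t : ℝ} (ht : t ∈ I) (w : W₁) :
      G (inl _ _ (line _ _ (t, w))) = line _ _ (t, .inl w) := by
    change G₁ (line _ _ (t, w)) = _
    exact descLine_line _ _ _ _ _ ht _
  have hG₂ {t : ℝ} (ht : t ∈ I) (w : W₂) :
      G (line _ _ (t, w)) = line _ _ (t, .inr w) := descLine_line _ _ _ _ _ ht _
  refine ⟨F, isHEquiv_of_inverse F G ?_ ?_⟩
  · refine ind (fun a => rfl) (fun b => ?_) fun t ht w => ?_
    · rcases b with b | b <;> rfl
    · rcases w with w | w
      · rw [hF₁ ht, hG₁ ht]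
      · rw [hF₂ ht, hG₂ ht]
  · refine ind (ind (fun a => rfl) (fun b => rfl) fun t ht w => ?_) (fun b => rfl) fun t ht w => ?_
    · rw [hG₁ ht, hF₁ ht]
    · rw [hG₂ ht, hF₂ ht]

end split

end constructions

end HPushout

/-! ### Joins with a point and further points -/

section join

variable {J K Z L : Type*} [TopologicalSpace J] [TopologicalSpace K] [TopologicalSpace Z]
  [TopologicalSpace L]

theorem exists_join_congr {f : C(J, K)} {g : C(Z, L)} (hf : IsHEquiv f) (hg : IsHEquiv g) :
    ∃ Θ : C(Join J Z, Join K L), IsHEquiv Θ := by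
  obtain ⟨Θ, h, -⟩ := HPushout.exists_map (f := ContinuousMap.fst) (g := ContinuousMap.snd)
    (f' := ContinuousMap.fst) (g' := ContinuousMap.snd) hf hg (hf.prodMap hg) (.refl _) (.refl _)
  exact ⟨Θ, h⟩

/-- The join with a disjoint union of a point and a space. -/
theorem exists_join_sum (J L : Type*) [TopologicalSpace J] [TopologicalSpace L] :
    ∃ Θ : C(Join J (PUnit.{1} ⊕ L), HPushout
      (ContinuousMap.const (J × L) PUnit.unit.{1}) (ContinuousMap.snd : C(J × L, L))),
      IsHEquiv Θ := by
  let f₁ : C(J × PUnit.{1}, J) := ContinuousMap.fst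
  let f₂ : C(J × L, J) := ContinuousMap.fst
  let g₁ : C(J × PUnit.{1}, PUnit.{1}) := ContinuousMap.snd
  let g₂ : C(J × L, L) := ContinuousMap.snd
  let e := Homeomorph.prodSumDistrib (X := J) (Y := PUnit.{1}) (Z := L)
  obtain ⟨Θ₁, h₁, -⟩ := HPushout.exists_map
    (f := (ContinuousMap.fst : C(J × (PUnit.{1} ⊕ L), J))) (g := ContinuousMap.snd)
    (f' := HPushout.sumElim f₁ f₂) (g' := HPushout.sumMap g₁ g₂)
    isHEquiv_id isHEquiv_id (isHEquiv_homeomorph e)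
    (by
      rw [show (ContinuousMap.id J).comp ContinuousMap.fst =
        (HPushout.sumElim f₁ f₂).comp (e : C(_, _)) from ContinuousMap.ext ?_]
      rintro ⟨j, z | z⟩ <;> rfl)
    (by
      rw [show (ContinuousMap.id _).comp ContinuousMap.snd =
        (HPushout.sumMap g₁ g₂).comp (e : C(_, _)) from ContinuousMap.ext ?_]
      rintro ⟨j, z | z⟩ <;> rfl)
  obtain ⟨Θ₂, h₂⟩ := HPushout.exists_split f₁ f₂ g₁ g₂
  have hf₁ : IsHEquiv f₁ :=
    isHEquiv_of_inverse f₁ ((ContinuousMap.id J).prodMk (.const _ PUnit.unit)) (fun _ => rfl)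
      fun _ => rfl
  -- The first step of the split pushout is the join of `J` with a point. It is contractible and is
  -- replaced by a point.
  have h₃ : IsHEquiv (HPushout.mapLeft ((HPushout.inl f₁ g₁).comp f₂) g₂
      (ContinuousMap.const _ PUnit.unit.{1}) (ContinuousMap.const _ PUnit.unit) fun _ => rfl) :=
    HPushout.isHEquiv_mapLeft (HPushout.isHEquiv_const hf₁) fun _ => rfl
  exact ⟨_, h₃.comp (h₂.comp h₁)⟩

end join

/-! ### Coning off wedges -/

section wedge

variable {L A Y : Type*} [TopologicalSpace L] [LocallyCompactSpace L] [TopologicalSpace A]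
  [TopologicalSpace Y] {k : ℕ} {a : A}

/-- The inclusion of a family of copies of `A` in a family of wedges. -/
def wedgeIncl (L : Type*) [TopologicalSpace L] (k : ℕ) (a : A) :
    C(L × Fin k × A, L × Wedge k A a) :=
  (ContinuousMap.id L).prodMap (HPushout.inr _ _)

/-- The projection of a family of copies of `A` to the set of indices. -/
def wedgeIndex (L : Type*) [TopologicalSpace L] (k : ℕ) (A : Type*) [TopologicalSpace A] :
    C(L × Fin k × A, L × Fin k) :=
  (ContinuousMap.id L).prodMap ContinuousMap.fst

/-- By pasting, crushing each summand to its index leaves the pushout along the composite of the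
base point inclusion with the index map. That composite is the identity of `L × Fin k`, so only `L ×
PUnit` remains. -/
theorem exists_collapse_wedge (L : Type*) [TopologicalSpace L] [LocallyCompactSpace L] (k : ℕ)
    (a : A) : ∃ β : C(HPushout (wedgeIncl L k a) (wedgeIndex L k A), L), IsHEquiv β ∧
      ∀ x, β (HPushout.inl _ _ x) = x.1 := by
  let β : C(HPushout (wedgeIncl L k a) (wedgeIndex L k A), L) :=
    HPushout.descLine ContinuousMap.fst ContinuousMap.fst ⟨fun q => q.2.1, by fun_prop⟩
      (fun _ => rfl) (fun _ => rfl)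
  refine ⟨β, ?_, fun _ => rfl⟩
  let c : C(L × Fin k, L × PUnit.{1}) :=
    (ContinuousMap.id L).prodMap (ContinuousMap.const (Fin k) PUnit.unit)
  let ι₀ : C(Fin k, Fin k × A) := ⟨fun i => (i, a), by fun_prop⟩
  let ι : C(L × Fin k, L × Fin k × A) := (ContinuousMap.id L).prodMap ι₀
  let γ := wedgeIndex L k A
  have h₁ : IsHEquiv (HPushout.inr (γ.comp ι) c) :=
    HPushout.isHEquiv_inr (isHEquiv_id : IsHEquiv (ContinuousMap.id (L × Fin k)))
  have h₂ := (HPushout.isHEquiv_paste γ ι c).comp h₁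
  -- The remaining equivalences swap the legs of the outer and inner pushouts and take the factor
  -- `L` out of the inner one.
  have h₃ := (HPushout.isHEquiv_swap _ _).comp h₂
  have h₄ := (HPushout.isHEquiv_mapLeft (f := HPushout.inl ι c) (g := γ)
    (f' := HPushout.inr c ι) (HPushout.isHEquiv_swap ι c) fun _ => rfl).comp h₃
  have h₅ := (HPushout.isHEquiv_mapLeft (f := HPushout.inr c ι) (g := γ)
    (f' := wedgeIncl L k a) (HPushout.isHEquiv_prodComparison _ ι₀) fun _ => rfl).comp h₄
  refine h₅.of_comp_right ?_
  exact isHEquiv_of_inverse _ ((ContinuousMap.id L).prodMk (.const _ PUnit.unit))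
    (fun _ => rfl) fun _ => rfl

/-- The homotopy pushout that cones off a family of wedges can be formed by coning off the
summands. -/
theorem exists_cone_wedge (ψ : C(L × Wedge k A a, Y)) :
    ∃ Θ : C(HPushout (ψ.comp (wedgeIncl L k a)) (wedgeIndex L k A),
      HPushout ψ (ContinuousMap.fst : C(L × Wedge k A a, L))), IsHEquiv Θ ∧
      ∀ y, Θ (HPushout.inl _ _ y) = HPushout.inl _ _ y := by
  obtain ⟨β, hβ, hl⟩ := exists_collapse_wedge L k a
  obtain ⟨Θ, h, hl', -⟩ := HPushout.exists_mapRight (f := ψ)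
    (g' := (ContinuousMap.fst : C(L × Wedge k A a, L))) hβ hl
  exact ⟨Θ.comp (HPushout.paste ψ _ _), h.comp (HPushout.isHEquiv_paste _ _ _), hl'⟩

end wedge

/-! ### Spheres as suspensions -/

section sphere

/-- The point of the sphere with given first coordinate and direction of the other coordinates. -/
noncomputable def spherePoint (d : ℕ) (t : ℝ) (y : UnitSphere d) : UnitSphere (d + 1) :=
  ⟨WithLp.toLp 2 (Fin.cons (Real.cos (Real.pi * t)) fun j => Real.sin (Real.pi * t) * y.1 j), by
    have hy : ∑ j, y.1 j ^ 2 = 1 := by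
      rw [← EuclideanSpace.real_norm_sq_eq, mem_sphere_zero_iff_norm.1 y.2, one_pow]
    rw [mem_sphere_zero_iff_norm, ← sq_eq_sq₀ (norm_nonneg _) zero_le_one,
      EuclideanSpace.real_norm_sq_eq]
    simp [Fin.sum_univ_succ, mul_pow, ← Finset.mul_sum, hy]⟩

theorem continuous_spherePoint (d : ℕ) :
    Continuous fun q : ℝ × UnitSphere d => spherePoint d q.1 q.2 := by
  refine Continuous.subtype_mk ((PiLp.continuous_toLp 2 _).comp ?_) _
  refine continuous_pi fun i => ?_
  refine Fin.cases ?_ (fun j => ?_) i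
  · simp only [Fin.cons_zero]
    fun_prop
  · simp only [Fin.cons_succ]
    have : Continuous fun q : ℝ × UnitSphere d => q.2.1 j := by fun_prop
    fun_prop

/-- The antipode of the base point of the sphere. -/
noncomputable def sphereAntipode (d : ℕ) : UnitSphere (d + 1) :=
  ⟨-(sphereBase d).1, by simp⟩

theorem spherePoint_zero (d : ℕ) (y : UnitSphere d) : spherePoint d 0 y = sphereBase d := by
  refine Subtype.ext (PiLp.ext fun i => ?_)
  refine Fin.cases ?_ (fun j => ?_) i
  · simp [spherePoint, sphereBase]
  · simp [spherePoint, sphereBase]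

theorem spherePoint_one (d : ℕ) (y : UnitSphere d) : spherePoint d 1 y = sphereAntipode d := by
  refine Subtype.ext (PiLp.ext fun i => ?_)
  refine Fin.cases ?_ (fun j => ?_) i
  · simp [spherePoint, sphereAntipode, sphereBase]
  · simp [spherePoint, sphereAntipode, sphereBase]

theorem spherePoint_inj {d : ℕ} {s t : ℝ} (hs : s ∈ I) (ht : t ∈ I) {x y : UnitSphere d}
    (h : spherePoint d s x = spherePoint d t y) : s = t ∧ (s ∈ Set.Ioo (0 : ℝ) 1 → x = y) := by
  have h' (i) : (spherePoint d s x).1 i = (spherePoint d t y).1 i := by rw [h]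
  have hp := Real.pi_pos
  have hst : s = t := by
    have h0 : Real.cos (Real.pi * s) = Real.cos (Real.pi * t) := by
      simpa [spherePoint] using h' 0
    have := Real.injOn_cos ⟨by nlinarith [hs.1], by nlinarith [hs.2]⟩
      ⟨by nlinarith [ht.1], by nlinarith [ht.2]⟩ h0
    exact mul_left_cancel₀ hp.ne' this
  subst hst
  refine ⟨rfl, fun hs => Subtype.ext (PiLp.ext fun j => ?_)⟩
  have hsin : 0 < Real.sin (Real.pi * s) :=
    Real.sin_pos_of_pos_of_lt_pi (mul_pos hp hs.1) (by nlinarith [hs.2])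
  have hj : Real.sin (Real.pi * s) * x.1 j = Real.sin (Real.pi * s) * y.1 j := by
    simpa [spherePoint] using h' j.succ
  exact mul_left_cancel₀ hsin.ne' hj

/-- The poles are separate cases because for `d = 0` the equator is empty and `spherePoint` takes no
values. At other points, `t` is the arccosine of the first coordinate divided by π, and `y` is the
normalized vector of the other coordinates. -/
theorem sphere_cases {d : ℕ} (x : UnitSphere (d + 1)) : x = sphereBase d ∨ x = sphereAntipode d ∨
    ∃ t ∈ I, ∃ y, x = spherePoint d t y := by
  have hp := Real.pi_pos
  have hx : x.1 0 ^ 2 + ∑ j : Fin d, x.1 j.succ ^ 2 = 1 := by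
    rw [← Fin.sum_univ_succ (fun i => x.1 i ^ 2), ← EuclideanSpace.real_norm_sq_eq,
      mem_sphere_zero_iff_norm.1 x.2, one_pow]
  have hnn : 0 ≤ ∑ j : Fin d, x.1 j.succ ^ 2 := Finset.sum_nonneg fun _ _ => sq_nonneg _
  rcases hnn.eq_or_lt with h0 | hpos
  · have hj (j : Fin d) : x.1 j.succ = 0 := by
      have := (Finset.sum_eq_zero_iff_of_nonneg fun _ _ => sq_nonneg _).1 h0.symm j
        (Finset.mem_univ j)
      exact pow_eq_zero_iff (two_ne_zero) |>.1 this
    rw [← h0, add_zero] at hx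
    rcases sq_eq_one_iff.1 hx with h | h
    · left
      refine Subtype.ext (PiLp.ext fun i => Fin.cases ?_ (fun j => ?_) i)
      · simp [sphereBase, h]
      · simp [sphereBase, hj]
    · right; left
      refine Subtype.ext (PiLp.ext fun i => Fin.cases ?_ (fun j => ?_) i)
      · simp [sphereBase, sphereAntipode, h]
      · simp [sphereBase, sphereAntipode, hj]
  · right; right
    set r := Real.sqrt (∑ j : Fin d, x.1 j.succ ^ 2) with hr
    have hrpos : 0 < r := Real.sqrt_pos.2 hpos
    have hr2 : r ^ 2 = ∑ j : Fin d, x.1 j.succ ^ 2 := Real.sq_sqrt hnn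
    have hmul : Real.pi * (Real.arccos (x.1 0) / Real.pi) = Real.arccos (x.1 0) := by
      field_simp
    refine ⟨Real.arccos (x.1 0) / Real.pi, ⟨div_nonneg (Real.arccos_nonneg _) hp.le,
      (div_le_one hp).2 (Real.arccos_le_pi _)⟩,
      ⟨WithLp.toLp 2 fun j => x.1 j.succ / r, ?_⟩, ?_⟩
    · rw [mem_sphere_zero_iff_norm, ← sq_eq_sq₀ (norm_nonneg _) zero_le_one,
        EuclideanSpace.real_norm_sq_eq]
      simp only [div_pow, ← Finset.sum_div, ← hr2]
      rw [one_pow, div_self (pow_pos hrpos 2).ne']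
    · refine Subtype.ext (PiLp.ext fun i => Fin.cases ?_ (fun j => ?_) i)
      · simp only [spherePoint, Fin.cons_zero, hmul]
        rw [Real.cos_arccos (by nlinarith) (by nlinarith)]
      · simp only [spherePoint, Fin.cons_succ, hmul, Real.sin_arccos]
        rw [show 1 - x.1 0 ^ 2 = ∑ j : Fin d, x.1 j.succ ^ 2 by linarith, ← hr]
        field_simp

/-- A family of spheres is the homotopy pushout of a family of spheres of one dimension less. -/
theorem exists_suspension_sphere (k d : ℕ) : ∃ Θ : C(HPushout
    (ContinuousMap.fst : C(Fin k × UnitSphere d, Fin k))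
    (ContinuousMap.fst : C(Fin k × UnitSphere d, Fin k)), Fin k × UnitSphere (d + 1)),
    IsHEquiv Θ ∧ ∀ i, Θ (HPushout.inl _ _ i) = (i, sphereBase d) := by
  let a : C(Fin k, Fin k × UnitSphere (d + 1)) := ⟨fun i => (i, sphereBase d), by fun_prop⟩
  let b : C(Fin k, Fin k × UnitSphere (d + 1)) := ⟨fun i => (i, sphereAntipode d), by fun_prop⟩
  let sph : C(ℝ × UnitSphere d, UnitSphere (d + 1)) :=
    ⟨fun q => spherePoint d q.1 q.2, continuous_spherePoint d⟩
  let h : C(ℝ × Fin k × UnitSphere d, Fin k × UnitSphere (d + 1)) :=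
    (ContinuousMap.fst.comp ContinuousMap.snd).prodMk
      (sph.comp (ContinuousMap.fst.prodMk (ContinuousMap.snd.comp ContinuousMap.snd)))
  have h₀ (w) : h (0, w) = a w.1 := congrArg (Prod.mk w.1) (spherePoint_zero d w.2)
  have h₁ (w) : h (1, w) = b w.1 := congrArg (Prod.mk w.1) (spherePoint_one d w.2)
  let Θ : C(HPushout (ContinuousMap.fst : C(Fin k × UnitSphere d, Fin k))
      (ContinuousMap.fst : C(Fin k × UnitSphere d, Fin k)), Fin k × UnitSphere (d + 1)) :=
    HPushout.descLine a b h h₀ h₁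
  refine ⟨Θ, ?_, fun _ => rfl⟩
  have hl {t : ℝ} (ht : t ∈ I) (w) : Θ (HPushout.line _ _ (t, w)) = (w.1, spherePoint d t w.2) :=
    HPushout.descLine_line _ _ _ _ _ ht w
  have hinl (i) : Θ (HPushout.inl _ _ i) = (i, sphereBase d) := rfl
  have hinr (i) : Θ (HPushout.inr _ _ i) = (i, sphereAntipode d) := rfl
  -- A continuous bijection from a compact space to a Hausdorff space is a homeomorphism, so only
  -- bijectivity is left to check.
  have hcompact : CompactSpace (HPushout (ContinuousMap.fst : C(Fin k × UnitSphere d, Fin k))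
      (ContinuousMap.fst : C(Fin k × UnitSphere d, Fin k))) :=
    inferInstanceAs (CompactSpace (Quot _))
  have hsurj : Function.Surjective Θ := by
    rintro ⟨i, x⟩
    rcases sphere_cases x with rfl | rfl | ⟨t, ht, y, rfl⟩
    · exact ⟨_, hinl i⟩
    · exact ⟨_, hinr i⟩
    · exact ⟨_, hl ht (i, y)⟩
  have hne : sphereBase d ≠ sphereAntipode d := fun h => by
    have := congrArg (fun x : UnitSphere (d + 1) => x.1 0) h
    norm_num [sphereBase, sphereAntipode] at this
  have hIoo {t : ℝ} (ht : t ∈ Set.Ioo (0 : ℝ) 1) (y : UnitSphere d) :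
      spherePoint d t y ≠ sphereBase d ∧ spherePoint d t y ≠ sphereAntipode d := by
    rw [← spherePoint_zero d y, ← spherePoint_one d y]
    have ht' := Set.Ioo_subset_Icc_self ht
    exact ⟨fun h => ht.1.ne' (spherePoint_inj ht' ⟨le_rfl, zero_le_one⟩ h).1,
      fun h => ht.2.ne (spherePoint_inj ht' ⟨zero_le_one, le_rfl⟩ h).1⟩
  have hinj : Function.Injective Θ := by
    intro x z
    refine HPushout.ind_Ioo (p := fun x => Θ x = Θ z → x = z) (fun i => ?_) (fun i => ?_)
      (fun t ht w => ?_) x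
    · refine HPushout.ind_Ioo (p := fun z => Θ (HPushout.inl _ _ i) = Θ z → HPushout.inl _ _ i = z)
        (fun j h => ?_) (fun j h => ?_) (fun s hs w h => ?_) z
      · exact congrArg _ (congrArg Prod.fst h :)
      · exact absurd (congrArg Prod.snd h) hne
      · rw [hl (Set.Ioo_subset_Icc_self hs)] at h
        exact absurd (congrArg Prod.snd h).symm (hIoo hs w.2).1
    · refine HPushout.ind_Ioo (p := fun z => Θ (HPushout.inr _ _ i) = Θ z → HPushout.inr _ _ i = z)
        (fun j h => ?_) (fun j h => ?_) (fun s hs w h => ?_) z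
      · exact absurd (congrArg Prod.snd h).symm hne
      · exact congrArg _ (congrArg Prod.fst h :)
      · rw [hl (Set.Ioo_subset_Icc_self hs)] at h
        exact absurd (congrArg Prod.snd h).symm (hIoo hs w.2).2
    · have ht' := Set.Ioo_subset_Icc_self ht
      rw [hl ht']
      refine HPushout.ind_Ioo (p := fun z => (w.1, spherePoint d t w.2) = Θ z →
        HPushout.line _ _ (t, w) = z) (fun j h => ?_) (fun j h => ?_) (fun s hs w' h => ?_) z
      · exact absurd (congrArg Prod.snd h) (hIoo ht w.2).1
      · exact absurd (congrArg Prod.snd h) (hIoo ht w.2).2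
      · have hs' := Set.Ioo_subset_Icc_self hs
        rw [hl hs'] at h
        obtain ⟨rfl, h₂⟩ := spherePoint_inj ht' hs' (congrArg Prod.snd h)
        rw [show w = w' from Prod.ext ((Prod.mk.inj h).1) (h₂ ht)]
  exact isHEquiv_homeomorph (Continuous.homeoOfEquivCompactToT2
    (f := Equiv.ofBijective Θ ⟨hinj, hsurj⟩) Θ.continuous)

end sphere

/-! ### Iterated joins as wedges of spheres -/

section wedgeOfSpheres

/-- The homotopy pushout of a point and `k` points along `k` spheres. -/
abbrev SphereCone (k d : ℕ) : Type :=
  HPushout (ContinuousMap.const (Fin k × UnitSphere d) PUnit.unit.{1})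
    (ContinuousMap.fst : C(Fin k × UnitSphere d, Fin k))

/-- The constant map factors through the index, so pasting presents the cone as a point glued to `k`
suspensions at their base points. -/
theorem exists_sphereCone_wedge (k d : ℕ) :
    ∃ Θ : C(SphereCone k d, Wedge k (UnitSphere (d + 1)) (sphereBase d)), IsHEquiv Θ := by
  obtain ⟨β, hβ, hl⟩ := exists_suspension_sphere k d
  obtain ⟨Θ, h, -⟩ := HPushout.exists_mapRight
    (f := ContinuousMap.const (Fin k) PUnit.unit.{1})
    (g' := (⟨fun i => (i, sphereBase d), by fun_prop⟩ :
      C(Fin k, Fin k × UnitSphere (d + 1)))) hβ hl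
  exact ⟨_, h.comp (HPushout.isHEquiv_paste (ContinuousMap.const (Fin k) PUnit.unit.{1})
    (ContinuousMap.fst : C(Fin k × UnitSphere d, Fin k)) ContinuousMap.fst)⟩

variable {J : Type*} [TopologicalSpace J] (l : ℕ)

/-- Used with `d = 0`, where the empty sphere yields a wedge of copies of S^0 and starts the
induction. -/
theorem exists_join_wedge_of_sphere {d : ℕ} {θ : C(J, UnitSphere d)} (hθ : IsHEquiv θ) :
    ∃ Θ : C(Join J (PUnit.{1} ⊕ Fin l), Wedge l (UnitSphere (d + 1)) (sphereBase d)),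
      IsHEquiv Θ := by
  obtain ⟨Θ₁, h₁⟩ := exists_join_sum J (Fin l)
  obtain ⟨Θ₂, h₂, -⟩ := HPushout.exists_map
    (f := ContinuousMap.const (J × Fin l) PUnit.unit.{1}) (g := ContinuousMap.snd)
    (f' := ContinuousMap.const (Fin l × UnitSphere d) PUnit.unit.{1}) (g' := ContinuousMap.fst)
    isHEquiv_id isHEquiv_id ((isHEquiv_homeomorph (Homeomorph.prodComm _ _)).comp
      (hθ.prodMap isHEquiv_id)) (.refl _) (.refl _)
  obtain ⟨Θ₃, h₃⟩ := exists_sphereCone_wedge l d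
  exact ⟨_, h₃.comp (h₂.comp h₁)⟩

/-- Each of the `l` copies of `J` contributes its `k` summands, and coning them off over a point
suspends each of them. -/
theorem exists_join_wedge_of_wedge {k d : ℕ}
    {θ : C(J, Wedge k (UnitSphere (d + 1)) (sphereBase d))} (hθ : IsHEquiv θ) :
    ∃ Θ : C(Join J (PUnit.{1} ⊕ Fin l), Wedge (l * k) (UnitSphere (d + 2)) (sphereBase (d + 1))),
      IsHEquiv Θ := by
  obtain ⟨Θ₁, h₁⟩ := exists_join_sum J (Fin l)
  obtain ⟨Θ₂, h₂, -⟩ := HPushout.exists_map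
    (f := ContinuousMap.const (J × Fin l) PUnit.unit.{1}) (g := ContinuousMap.snd)
    (f' := ContinuousMap.const (Fin l × Wedge k (UnitSphere (d + 1)) (sphereBase d))
      PUnit.unit.{1}) (g' := ContinuousMap.fst)
    isHEquiv_id isHEquiv_id ((isHEquiv_homeomorph (Homeomorph.prodComm _ _)).comp
      (hθ.prodMap isHEquiv_id)) (.refl _) (.refl _)
  obtain ⟨Θ₃, h₃, -⟩ := exists_cone_wedge (ContinuousMap.const
    (Fin l × Wedge k (UnitSphere (d + 1)) (sphereBase d)) PUnit.unit.{1})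
  obtain ⟨e₃, -⟩ := h₃.exists_equiv
  let e := (finProdFinEquiv (m := l) (n := k)).toHomeomorphOfDiscrete
  obtain ⟨Θ₄, h₄, -⟩ := HPushout.exists_map
    (f := (ContinuousMap.const (Fin l × Wedge k (UnitSphere (d + 1)) (sphereBase d))
      PUnit.unit.{1}).comp (wedgeIncl (Fin l) k (sphereBase d)))
    (g := wedgeIndex (Fin l) k (UnitSphere (d + 1)))
    (f' := ContinuousMap.const (Fin (l * k) × UnitSphere (d + 1)) PUnit.unit.{1})
    (g' := ContinuousMap.fst)
    isHEquiv_id (isHEquiv_homeomorph e) (isHEquiv_homeomorph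
      ((Homeomorph.prodAssoc _ _ _).symm.trans (e.prodCongr (Homeomorph.refl _))))
    (.refl _) (.refl _)
  obtain ⟨Θ₅, h₅⟩ := exists_sphereCone_wedge (l * k) (d + 1)
  exact ⟨_, h₅.comp (h₄.comp ((isHEquiv_toFun e₃.symm).comp (h₂.comp h₁)))⟩

theorem exists_zmod_homeomorph {m : ℕ} (hm : 1 ≤ m) :
    Nonempty (ZMod m ≃ₜ PUnit.{1} ⊕ Fin (m - 1)) := by
  have : NeZero m := ⟨by omega⟩
  refine ⟨(Fintype.equivOfCardEq ?_).toHomeomorphOfDiscrete⟩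
  rw [ZMod.card, Fintype.card_sum, Fintype.card_fin, Fintype.card_punit]
  omega

theorem isHEquiv_of_isEmpty {X Y : Type*} [TopologicalSpace X] [TopologicalSpace Y] [IsEmpty X]
    [IsEmpty Y] (f : C(X, Y)) : IsHEquiv f :=
  isHEquiv_of_inverse f ⟨isEmptyElim, continuous_of_const fun x => isEmptyElim x⟩
    (fun x => isEmptyElim x) fun y => isEmptyElim y

instance isEmpty_unitSphere_zero : IsEmpty (UnitSphere 0) :=
  ⟨fun x => by simpa [Subsingleton.elim x.1 0] using mem_sphere_zero_iff_norm.1 x.2⟩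

theorem exists_joinPow_zero (m : ℕ) : ∃ Θ : C(joinPow (ZMod m) 0, UnitSphere 0), IsHEquiv Θ :=
  have : IsEmpty (joinPow (ZMod m) 0) := inferInstanceAs (IsEmpty PEmpty)
  ⟨⟨isEmptyElim, continuous_of_const fun x => isEmptyElim x⟩, isHEquiv_of_isEmpty _⟩

/-- The induction starts with one factor, since the empty sphere has no base point at which to form
a wedge. -/
theorem exists_joinPow_wedge {m : ℕ} (hm : 1 ≤ m) (n : ℕ) : ∃ Θ : C(joinPow (ZMod m) (n + 1),
    Wedge ((m - 1) ^ (n + 1)) (UnitSphere (n + 1)) (sphereBase n)), IsHEquiv Θ := by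
  obtain ⟨e⟩ := exists_zmod_homeomorph hm
  have split (n : ℕ) : ∃ Θ : C(joinPow (ZMod m) (n + 1),
      Join (joinPow (ZMod m) n) (PUnit.{1} ⊕ Fin (m - 1))), IsHEquiv Θ :=
    exists_join_congr isHEquiv_id (isHEquiv_homeomorph e)
  induction n with
  | zero =>
    obtain ⟨Θ₁, h₁⟩ := split 0
    obtain ⟨θ, hθ⟩ := exists_joinPow_zero m
    obtain ⟨Θ₂, h₂⟩ := exists_join_wedge_of_sphere (m - 1) hθ
    have hk : (m - 1) ^ (0 + 1) = m - 1 := by simp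
    rw [hk]
    exact ⟨_, h₂.comp h₁⟩
  | succ n ih =>
    obtain ⟨Θ₁, h₁⟩ := split (n + 1)
    obtain ⟨θ, hθ⟩ := ih
    obtain ⟨Θ₂, h₂⟩ := exists_join_wedge_of_wedge (m - 1) hθ
    rw [pow_succ']
    exact ⟨_, h₂.comp h₁⟩

end wedgeOfSpheres

/-! ### Fibres of the iterated joins and attachment of cells -/

section resolution

variable {B : Type u} [TopologicalSpace B] {b : B} {m : ℕ}

theorem IsDelooping.exists_loopSpace (h : IsDelooping (ZMod m) B b) :
    ∃ Θ : C(LoopSpace b, ZMod m), IsHEquiv Θ := by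
  obtain ⟨e, -⟩ := h.loopEquiv
  let f : C(LoopSpace b, Path b b) :=
    ⟨fun x => ⟨x.1.2.1, x.2.1, x.2.2⟩, continuous_induced_rng.2
      (continuous_fst.comp (continuous_snd.comp continuous_subtype_val))⟩
  let g : C(Path b b, LoopSpace b) :=
    ⟨fun p => ⟨(PUnit.unit, p, PUnit.unit), p.source, p.target⟩, by
      refine Continuous.subtype_mk (continuous_const.prodMk
        (Continuous.prodMk continuous_induced_dom continuous_const)) _⟩
  have hf : IsHEquiv f := isHEquiv_of_inverse f g (fun _ => rfl) fun _ => rfl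
  exact ⟨_, (isHEquiv_toFun e).comp hf⟩

/-- Both sides start empty, and each step joins them with equivalent spaces: `ZMod m` on one side
and, by `exists_join_fiber`, the loop space on the other. -/
theorem IsDelooping.exists_fiber (h : IsDelooping (ZMod m) B b) (n : ℕ) :
    ∃ Θ : C(joinPow (ZMod m) n, Fiber (iterJoinMap (basePoint b) n).2 b), IsHEquiv Θ := by
  induction n with
  | zero =>
    have : IsEmpty (joinPow (ZMod m) 0) := inferInstanceAs (IsEmpty PEmpty)
    have : IsEmpty (Fiber (iterJoinMap (basePoint b) 0).2 b) := ⟨fun x => PEmpty.elim x.1.1⟩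
    exact ⟨⟨isEmptyElim, continuous_of_const fun x => isEmptyElim x⟩, isHEquiv_of_isEmpty _⟩
  | succ n ih =>
    obtain ⟨Θ₁, h₁⟩ := ih
    obtain ⟨Θ₂, h₂⟩ := h.exists_loopSpace
    obtain ⟨e₂, -⟩ := h₂.exists_equiv
    obtain ⟨Θ₃, h₃⟩ := exists_join_congr h₁ (isHEquiv_toFun e₂.symm)
    obtain ⟨Θ₄, h₄⟩ := exists_join_fiber (iterJoinMap (basePoint b) n).2 b
    exact ⟨_, h₄.comp h₃⟩

/-- If the homotopy fiber of `p` is a wedge of spheres, then the join of `p` with the base point is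
obtained by attaching cells. -/
theorem attachesCells_of_fiber {E : Type u} [TopologicalSpace E] (p : C(E, B)) {k n : ℕ}
    {θ : C(Wedge k (UnitSphere (n + 1)) (sphereBase n), Fiber p b)} (hθ : IsHEquiv θ) :
    AttachesCells k n (HPushout.inl (HPullback.fst p (basePoint b))
      (HPullback.snd p (basePoint b))) := by
  let V := Wedge k (UnitSphere (n + 1)) (sphereBase n)
  -- The factor `PUnit` turns the wedge into a family indexed by one point, the form in which
  -- `exists_cone_wedge` applies.
  let ψ : C(PUnit.{1} × V, E) := (HPullback.fst p (basePoint b)).comp (θ.comp ContinuousMap.snd)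
  let s : C(Fin k × UnitSphere (n + 1), PUnit.{1} × Fin k × UnitSphere (n + 1)) :=
    (ContinuousMap.const _ PUnit.unit).prodMk (.id _)
  have hs : IsHEquiv s := isHEquiv_of_inverse s ContinuousMap.snd (fun _ => rfl) fun _ => rfl
  let i : C(Fin k, PUnit.{1} × Fin k) := (ContinuousMap.const _ PUnit.unit).prodMk (.id _)
  have hi : IsHEquiv i := isHEquiv_of_inverse i ContinuousMap.snd (fun _ => rfl) fun _ => rfl
  have hV : IsHEquiv (ContinuousMap.snd : C(PUnit.{1} × V, V)) :=
    isHEquiv_of_inverse _ ((ContinuousMap.const _ PUnit.unit).prodMk (.id _)) (fun _ => rfl)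
      fun _ => rfl
  have hpt : IsHEquiv (ContinuousMap.const PUnit.{1} PUnit.unit.{u + 1}) :=
    isHEquiv_of_inverse _ (.const _ PUnit.unit) (fun _ => rfl) fun _ => rfl
  let ω := wedgeIncl PUnit.{1} k (sphereBase n)
  obtain ⟨Θ₁, h₁, l₁, -⟩ := HPushout.exists_map (f := (ψ.comp ω).comp s) (g := ContinuousMap.fst)
    (f' := ψ.comp ω) (g' := wedgeIndex PUnit.{1} k (UnitSphere (n + 1))) isHEquiv_id hi hs
    (.refl _) (.refl _)
  obtain ⟨Θ₂, h₂, l₂⟩ := exists_cone_wedge ψ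
  obtain ⟨Θ₃, h₃, l₃, -⟩ := HPushout.exists_map (f := ψ)
    (g := (ContinuousMap.fst : C(PUnit.{1} × V, PUnit.{1})))
    (f' := HPullback.fst p (basePoint b)) (g' := HPullback.snd p (basePoint b))
    isHEquiv_id hpt (hθ.comp hV) (.refl _) (.refl _)
  obtain ⟨e, he⟩ := (h₃.comp (h₂.comp h₁)).exists_equiv
  refine ⟨(ψ.comp ω).comp s, e, ?_⟩
  -- All three equivalences are strictly the identity on `E`, so the required homotopy is an
  -- equality.
  rw [he, show ((Θ₃.comp (Θ₂.comp Θ₁)).comp (HPushout.inl _ _)) = HPushout.inl _ _ from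
    ContinuousMap.ext fun y => ?_]
  change Θ₃ (Θ₂ (Θ₁ (HPushout.inl _ _ y))) = _
  rw [l₁, l₂, l₃]
  rfl

theorem IsDelooping.attachesCells (hm : 1 ≤ m) (h : IsDelooping (ZMod m) B b) (n : ℕ) :
    AttachesCells ((m - 1) ^ (n + 1)) n (resolutionIncl B b n) := by
  obtain ⟨Θ₁, h₁⟩ := exists_joinPow_wedge hm n
  obtain ⟨e₁, -⟩ := h₁.exists_equiv
  -- The map from `L̃^n` to `B` is the `(n + 1)`-fold join, so its fibre is the `(n + 1)`-fold join
  -- of `ZMod m`, a wedge of spheres of dimension `n`.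
  obtain ⟨Θ₂, h₂⟩ := h.exists_fiber (n + 1)
  exact attachesCells_of_fiber (iterJoinMap (basePoint b) (n + 1)).2
    (h₂.comp (isHEquiv_toFun e₁.symm))

end resolution

end HoTop

theorem mainTheorem8 (m : ℕ) (hm : 1 ≤ m) :
    -- for `n = 0`, one copy of `S^{-1}`; then the case of the `(n + 1)`-fold join
    Nonempty (ContinuousMap.HomotopyEquiv (HoTop.joinPow (ZMod m) 0) (HoTop.UnitSphere 0)) ∧
    (∀ n : ℕ, Nonempty (ContinuousMap.HomotopyEquiv (HoTop.joinPow (ZMod m) (n + 1))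
      (HoTop.Wedge ((m - 1) ^ (n + 1)) (HoTop.UnitSphere (n + 1)) (HoTop.sphereBase n)))) ∧
    -- attaching cells to the non-minimal resolution built from any delooping of `ZMod m`
    (∀ (B : Type*) [TopologicalSpace B] (b : B), HoTop.IsDelooping (ZMod m) B b →
      ∀ n : ℕ, HoTop.AttachesCells ((m - 1) ^ (n + 1)) n (HoTop.resolutionIncl B b n)) :=
  ⟨let ⟨_, h⟩ := HoTop.exists_joinPow_zero m; h.nonempty,
    fun n => let ⟨_, h⟩ := HoTop.exists_joinPow_wedge hm n; h.nonempty,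
    fun _ _ _ h n => h.attachesCells hm n⟩
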